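/- **Notation.** Let $F$ be the free group on $x,y$, let $\Gamma=\mathrm{Aut}\,F$ (automorphisms composed from right to left), and let $\mathrm{Int}\,F\subset\Gamma$ be the subgroup of inner automorphisms. For a normal subgroup $K\subset F$ of finite index put $$\Gamma[K]=\{\sigma\in\Gamma:\ \sigma(K)=K\text{ and }\sigma\text{ acts trivially on }F/K\}.$$ Let $\theta:\Gamma\to\mathrm{Aut}(F/[F,F])=GL_2(\mathbb Z)$ be the canonical homomorphism, let $SL_2'(\mathbb Z)\subset SL_2(\mathbb Z)$ be the subgroup generated by $\begin{pmatrix}1&2\\0&1\end{pmatrix}$ and $\begin{pmatrix}1&0\\2&1\end{pmatrix}$, and let $\mathrm{Aut}'F=\theta^{-1}(SL_2'(\mathbb Z))$. For a group $H$ and $k\ge 1$ let $H^k[H,H]$ be the subgroup generated by the $k$-th powers and the commutators of elements of $H$. **Construction.** Let $N\subset\Gamma$ be a subgroup and $p,q$ primes. Let $\Phi$ be the free group on $a,b$ and let $\nu_0:\Phi\to\Gamma$ send $a$ to $\alpha:(x\mapsto x,\ y\mapsto yx^2)$ and $b$ to $\beta:(x\mapsto xy^2,\ y\mapsto y)$.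 Put $$\mathcal N=\nu_0^{-1}(N),\qquad \mathcal M=\mathcal N^p[\mathcal N,\mathcal N].$$ Let $\Psi=\langle z_1\rangle*\langle z_2\rangle*\langle z_3\rangle$ with each $z_i$ of order $2$. Identify $F$ with a subgroup of $\Psi$ by $x=z_1z_2$, $y=z_2z_3$, and let $F'\subset\Psi$ be the subgroup freely generated by $u=z_1z_2z_3$, $v=z_2z_3z_1$, $w=z_3z_1z_2$. Let $\rho:F'\to F(\bar u,\bar w)$ be the homomorphism to the free group on $\bar u,\bar w$ with $u\mapsto\bar u$, $v\mapsto 1$, $w\mapsto\bar w$, and let $\phi:\Phi\to F(\bar u,\bar w)$ be the isomorphism with $a\mapsto(\bar u\bar w)^{-1}$, $b\mapsto\bar u^{-1}$. Define successively $$M=F\cap\rho^{-1}(\phi(\mathcal M)),\qquad S=\bigcap_{g\in F}gMg^{-1},\qquad T=S\cap F^6[F,F],$$ $$U=T^q[T,T],\qquad K=U\cap F^4[F,F].$$ **Theorem.** Let $N$ be a finite-index normal subgroup of $\Gamma$ with $\mathrm{Int}\,F\subset N\subset\mathrm{Aut}'F$, and let $n=[\mathrm{Aut}'F:N]$. Let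 $p,q$ be distinct odd primes, neither dividing $n$, and put $m=n\cdot p^{\,n+1}$. Then the explicitly constructed subgroup $K\subset F$ above is normal in $F$, its index $[F:K]$ divides $144\,m^4\cdot q^{\,36m^4+1}$, and $\Gamma[K]\subset N$. -/

import Mathlib

namespace AutF2

/-- `Γ[K]`: the automorphisms `σ` of `G` with `σ(K) = K` that act trivially on `G/K`. -/
def congruenceSubgroup {G : Type*} [Group G] (K : Subgroup G) : Subgroup (MulAut G) where
  carrier := {σ | K.map σ.toMonoidHom = K ∧ ∀ g : G, ((σ g : G) : G ⧸ K) = (g : G ⧸ K)}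
  one_mem' := by
    refine ⟨?_, fun g => rfl⟩
    exact Subgroup.map_id K
  mul_mem' := by
    rintro σ τ ⟨hσ, hσ'⟩ ⟨hτ, hτ'⟩
    refine ⟨?_, fun g => (hσ' (τ g)).trans (hτ' g)⟩
    have h : (σ * τ).toMonoidHom = σ.toMonoidHom.comp τ.toMonoidHom := rfl
    rw [h, ← Subgroup.map_map, hτ, hσ]
  inv_mem' := by
    rintro σ ⟨hσ, hσ'⟩
    refine ⟨?_, fun g => ?_⟩
    · have h : (σ⁻¹).toMonoidHom.comp σ.toMonoidHom = MonoidHom.id G := by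
        ext g
        exact σ.symm_apply_apply g
      conv_lhs => rw [← hσ]
      rw [Subgroup.map_map, h, Subgroup.map_id]
    · have h := hσ' (σ⁻¹ g)
      rw [MulAut.apply_inv_self] at h
      exact h.symm

/-- `H^k[H,H]`: the subgroup generated by the `k`-th powers of elements of `H` and by the
commutators of elements of `H`. -/
def powComm {G : Type*} [Group G] (k : ℕ) (H : Subgroup G) : Subgroup G :=
  Subgroup.closure ((fun h : G => h ^ k) '' (H : Set G)) ⊔ ⁅H, H⁆

/-- The free group `F` on `x` and `y`. -/
abbrev F : Type := FreeGroup (Fin 2)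

/-- The first free generator of `F`. -/
def x : F := FreeGroup.of 0

/-- The second free generator of `F`. -/
def y : F := FreeGroup.of 1

/-! ### The homomorphism `θ : Aut F → GL₂(ℤ)` and the subgroup `Aut′ F` -/

/-- The abelianization map `F → ℤ²` (exponent sums). -/
def expSum : F →* Multiplicative (Fin 2 → ℤ) :=
  FreeGroup.lift fun i => Multiplicative.ofAdd (Pi.single i 1)

/-- The matrix of the map that `σ` induces on `F^ab = ℤ²`: its `j`-th column is the image of the
`j`-th generator. -/
def abMatrix (σ : MulAut F) : Matrix (Fin 2) (Fin 2) ℤ :=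
  Matrix.of fun i j => (expSum (σ (FreeGroup.of j))).toAdd i

theorem abMatrix_mulVec (σ : MulAut F) (w : F) :
    (abMatrix σ).mulVec (expSum w).toAdd = (expSum (σ w)).toAdd := by
  let f : F →* Multiplicative (Fin 2 → ℤ) :=
    (AddMonoidHom.toMultiplicative (abMatrix σ).mulVecLin.toAddMonoidHom).comp expSum
  have h : f = expSum.comp σ.toMonoidHom := by
    refine FreeGroup.ext_hom _ _ fun j => ?_
    apply Multiplicative.toAdd.injective
    change (abMatrix σ).mulVec (expSum (FreeGroup.of j)).toAdd = (expSum (σ (FreeGroup.of j))).toAdd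
    funext i
    simp [expSum, abMatrix]
  exact congrArg Multiplicative.toAdd (DFunLike.congr_fun h w)

/-- The canonical homomorphism `θ : Aut F → Aut F^ab = GL₂(ℤ)`. -/
def theta : MulAut F →* GL (Fin 2) ℤ :=
  MonoidHom.toHomUnits
    { toFun := abMatrix
      map_one' := by
        ext i j
        simp [abMatrix, expSum, Matrix.one_apply, Pi.single_apply]
      map_mul' := by
        intro σ τ
        ext i j
        have h := congrFun (abMatrix_mulVec σ (τ (FreeGroup.of j))) i
        exact h.symm }

/-- `SL′₂(ℤ)`: the subgroup of `SL₂(ℤ)` generated by the two elementary matrices with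
off-diagonal entry `2`. -/
def SLprime : Subgroup (Matrix.SpecialLinearGroup (Fin 2) ℤ) :=
  Subgroup.closure
    {⟨!![1, 2; 0, 1], by simp [Matrix.det_fin_two]⟩, ⟨!![1, 0; 2, 1], by simp [Matrix.det_fin_two]⟩}

/-- `Aut′ F`: the preimage of `SL′₂(ℤ)` under `θ`. -/
def autPrime : Subgroup (MulAut F) :=
  (SLprime.map (Matrix.SpecialLinearGroup.toGL (n := Fin 2) (R := ℤ))).comap theta

/-- `Int F`: the inner automorphisms. -/
def intF : Subgroup (MulAut F) := (MulAut.conj : F →* MulAut F).range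

/-! ### The homomorphism `ν₀ : Φ → Aut F` -/

/-- The automorphism `x ↦ x`, `y ↦ y x²`. -/
def alpha : MulAut F :=
  MonoidHom.toMulEquiv (FreeGroup.lift ![x, y * x ^ 2]) (FreeGroup.lift ![x, y * (x ^ 2)⁻¹])
    (by
      refine FreeGroup.ext_hom _ _ fun i => ?_
      fin_cases i <;> simp [x, y])
    (by
      refine FreeGroup.ext_hom _ _ fun i => ?_
      fin_cases i <;> simp [x, y])

/-- The automorphism `x ↦ x y²`, `y ↦ y`. -/
def beta : MulAut F :=
  MonoidHom.toMulEquiv (FreeGroup.lift ![x * y ^ 2, y]) (FreeGroup.lift ![x * (y ^ 2)⁻¹, y])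
    (by
      refine FreeGroup.ext_hom _ _ fun i => ?_
      fin_cases i <;> simp [x, y])
    (by
      refine FreeGroup.ext_hom _ _ fun i => ?_
      fin_cases i <;> simp [x, y])

/-- The free group `Φ` on `a` (index `0`) and `b` (index `1`). -/
abbrev Phi : Type := FreeGroup (Fin 2)

/-- `ν₀ : Φ → Aut F`, `a ↦ α`, `b ↦ β`. -/
def nu0 : Phi →* MulAut F := FreeGroup.lift ![alpha, beta]

/-! ### The groups `Ψ ⊇ F, F′` and the map `ρ : F′ → F(ū, w̄)` -/

/-- `Ψ = ⟨z₁⟩ * ⟨z₂⟩ * ⟨z₃⟩`, the free product of three groups of order two. -/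
abbrev Psi : Type := Monoid.CoprodI fun _ : Fin 3 => Multiplicative (ZMod 2)

/-- The involution `z_{i+1}` of `Ψ`, for `i = 0, 1, 2`. -/
def z (i : Fin 3) : Psi := Monoid.CoprodI.of (i := i) (Multiplicative.ofAdd (1 : ZMod 2))

/-- The embedding `F → Ψ`, `x ↦ z₁z₂`, `y ↦ z₂z₃`. -/
def inclF : F →* Psi := FreeGroup.lift ![z 0 * z 1, z 1 * z 2]

/-- The embedding of `F′ = F(u, v, w)` in `Ψ`: `u ↦ z₁z₂z₃`, `v ↦ z₂z₃z₁`, `w ↦ z₃z₁z₂`. -/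
def inclF' : FreeGroup (Fin 3) →* Psi :=
  FreeGroup.lift ![z 0 * z 1 * z 2, z 1 * z 2 * z 0, z 2 * z 0 * z 1]

/-- The free group `F(ū, w̄)`, with `ū` of index `0` and `w̄` of index `1`. -/
abbrev Fbar : Type := FreeGroup (Fin 2)

/-- `ρ : F′ → F(ū, w̄)`, `u ↦ ū`, `v ↦ 1`, `w ↦ w̄`. -/
def rho : FreeGroup (Fin 3) →* Fbar :=
  FreeGroup.lift ![FreeGroup.of 0, 1, FreeGroup.of 1]

/-- The isomorphism `φ : Φ → F(ū, w̄)`, `a ↦ (ūw̄)⁻¹`, `b ↦ ū⁻¹`. The inverses are there because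
automorphisms are composed from right to left and `MulAut.conj g` is `h ↦ g h g⁻¹`: with them, the
action of `r ∈ Φ` on `F(ū, w̄)` is conjugation by `φ r`, that is `h ↦ (φ r) h (φ r)⁻¹`. -/
def phi : Phi →* Fbar :=
  FreeGroup.lift ![(FreeGroup.of 0 * FreeGroup.of 1)⁻¹, (FreeGroup.of 0)⁻¹]

/-! ### The explicit subgroup `K` -/

/-- `𝒩 ⊆ Φ`, the subgroup corresponding to `N / Int F` under `Φ ≅ Aut′ F / Int F`. -/
def scriptN (N : Subgroup (MulAut F)) : Subgroup Phi := N.comap nu0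

/-- `ℳ = 𝒩^p[𝒩,𝒩]`. -/
def scriptM (N : Subgroup (MulAut F)) (p : ℕ) : Subgroup Phi := powComm p (scriptN N)

/-- `M = M′ ∩ F`, where `M′ = ρ⁻¹(φ(ℳ)) ⊆ F′`; the intersection is taken inside `Ψ`. -/
def subgroupM (N : Subgroup (MulAut F)) (p : ℕ) : Subgroup F :=
  ((((scriptM N p).map phi).comap rho).map inclF').comap inclF

/-- `S = ⋂_{g ∈ F} g M g⁻¹`. -/
def subgroupS (N : Subgroup (MulAut F)) (p : ℕ) : Subgroup F := (subgroupM N p).normalCore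

/-- `T = S ∩ F⁶[F,F]`. -/
def subgroupT (N : Subgroup (MulAut F)) (p : ℕ) : Subgroup F := subgroupS N p ⊓ powComm 6 ⊤

/-- `U = T^q[T,T]`. -/
def subgroupU (N : Subgroup (MulAut F)) (p q : ℕ) : Subgroup F := powComm q (subgroupT N p)

/-- `K = U ∩ F⁴[F,F]`. -/
def subgroupK (N : Subgroup (MulAut F)) (p q : ℕ) : Subgroup F := subgroupU N p q ⊓ powComm 4 ⊤

end AutF2

/-!
By Nielsen's theory every automorphism of `F` acting trivially on `F/F²[F,F]` is, up to inner
automorphisms and sign changes, the image under `ν₀` of some `r ∈ Φ`; Sanov's congruences show that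
one acting trivially on `F/F⁴[F,F]` involves no sign change. So let `σ = conj g ∘ ν₀(r)` lie in
`Γ[K]`. As `Int F ≤ N`, it must be shown that `r ∈ 𝒩`.

The action of `Φ` on `F` extends to `Ψ`, where conjugation by `z₂` induces an involution of `F` that
preserves `T`. The key fact concerns a homomorphism from a free group of rank at least two to a
finite group, with kernel `T`: if `q > 2`, an element commuting with everything modulo `T^q[T,T]`
lies in `T`, and in the case of `F` one commuting with `[y, x]` modulo `T^q[T,T]` lies in
`⟨[y, x]⟩ T`. Both follow from the Fox derivatives, which are cocycles with values in the functions
on the finite group. Since `σ` is trivial modulo `U = T^q[T,T]`, the extension of `σ` to `Ψ` is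
trivial modulo `T`; and since `ν₀(r)` fixes `[y, x]`, `g ∈ ⟨[y, x]⟩ T`. As `[y, x] = v²` is killed
by `ρ`, restricting to `F′` and applying `ρ` shows that `μ r` is central modulo `ℳ = 𝒩^p[𝒩,𝒩]`
for some `μ ∈ ℳ`. By the key fact for `p` and `Φ`, `μ r ∈ 𝒩`, hence `r ∈ 𝒩`.

The bound on the index comes from `[H : H^k[H,H]] ∣ k^((d - 1) [G : H] + 1)` for a subgroup `H` of
finite index in a group `G` on `d` generators.
-/

namespace AutF2

open scoped commutatorElement

/-! ### The Gromov product on a free group -/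

section CommonPrefix

variable {β : Type*} [DecidableEq β]

/-- The length of the longest common prefix of two lists. -/
def commonPrefixLength : List β → List β → ℕ
  | a :: l, b :: m => if a = b then commonPrefixLength l m + 1 else 0
  | [], _ => 0
  | _ :: _, [] => 0

theorem commonPrefixLength_comm (l m : List β) :
    commonPrefixLength l m = commonPrefixLength m l := by
  induction l generalizing m with
  | nil => cases m <;> rfl
  | cons a l ih =>
    cases m with
    | nil => rfl
    | cons b m => simp only [commonPrefixLength, ih m, eq_comm]

theorem min_commonPrefixLength_le (l k m : List β) :
    min (commonPrefixLength l k) (commonPrefixLength k m) ≤ commonPrefixLength l m := by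
  induction l generalizing k m with
  | nil => simp [commonPrefixLength]
  | cons a l ih =>
    match k, m with
    | [], _ => simp [commonPrefixLength]
    | _ :: _, [] => simp [commonPrefixLength]
    | b :: k, c :: m =>
      have := ih k m
      simp only [commonPrefixLength]
      split_ifs <;> first | omega | simp_all

theorem exists_append_commonPrefixLength (l m : List β) :
    ∃ p l' m', l = p ++ l' ∧ m = p ++ m' ∧ p.length = commonPrefixLength l m := by
  induction l generalizing m with
  | nil => exact ⟨[], [], m, rfl, rfl, rfl⟩
  | cons a l ih =>
    match m with
    | [] => exact ⟨[], a :: l, [], rfl, rfl, rfl⟩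
    | b :: m =>
      simp only [commonPrefixLength]
      split_ifs with hab
      · obtain ⟨p, l', m', hl, hm, hp⟩ := ih m
        exact ⟨a :: p, l', m', by simp [hl], by simp [hm, hab], by simp [hp]⟩
      · exact ⟨[], _, _, rfl, rfl, rfl⟩

end CommonPrefix

section GromovProduct

open FreeGroup

variable {α : Type*}

theorem isReduced_invRev_append {a b : α × Bool} {l m : List (α × Bool)}
    (hl : IsReduced (a :: l)) (hm : IsReduced (b :: m)) (hab : a ≠ b) :
    IsReduced (invRev (a :: l) ++ b :: m) := by
  classical
  have hinv : IsReduced (invRev (a :: l)) := by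
    rw [isReduced_iff_reduce_eq] at hl ⊢
    rw [reduce_invRev, hl]
  refine List.isChain_append.2 ⟨hinv, hm, ?_⟩
  simp only [invRev, List.map_cons, List.reverse_cons, List.getLast?_append,
    List.getLast?_singleton, Option.some_or, Option.mem_def, Option.some.injEq, List.head?_cons]
  rintro _ rfl _ rfl (hfst : a.1 = b.1)
  exact (Bool.eq_not_of_ne fun hsnd : b.2 = a.2 => hab (Prod.ext hfst hsnd.symm)).symm

variable [DecidableEq α]

local notation "ℓ" => FreeGroup.norm

theorem norm_mk_of_isReduced {l : List (α × Bool)} (hl : IsReduced l) : ℓ (mk l) = l.length := by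
  rw [FreeGroup.norm, toWord_mk, hl.reduce_eq]

theorem norm_mk_inv_mul_mk {l m : List (α × Bool)} (hl : IsReduced l) (hm : IsReduced m) :
    ℓ ((mk l)⁻¹ * mk m) + 2 * commonPrefixLength l m = l.length + m.length := by
  induction l generalizing m with
  | nil => simp [commonPrefixLength, ← one_eq_mk, norm_mk_of_isReduced hm]
  | cons a l ih =>
    match m with
    | [] => simp [commonPrefixLength, ← one_eq_mk, -inv_mk, norm_mk_of_isReduced hl]
    | b :: m =>
      simp only [commonPrefixLength]
      split_ifs with hab
      · subst hab
        have hsplit (k : List (α × Bool)) : mk (a :: k) = mk [a] * mk k := by rw [mul_mk]; rfl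
        have hcancel : (mk (a :: l))⁻¹ * mk (a :: m) = (mk l)⁻¹ * mk m := by
          rw [hsplit l, hsplit m]
          group
        have := ih (hl.infix (List.suffix_cons a l).isInfix)
          (hm.infix (List.suffix_cons a m).isInfix)
        rw [hcancel, List.length_cons, List.length_cons]
        omega
      · rw [inv_mk, mul_mk, norm_mk_of_isReduced (isReduced_invRev_append hl hm hab),
          List.length_append, invRev_length, mul_zero, add_zero]

/-- The Gromov product of `g` and `h` based at `1`, for the word metric: the length of the longest
common prefix of their reduced words. -/
def gromovProduct (g h : FreeGroup α) : ℕ := commonPrefixLength g.toWord h.toWord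

theorem norm_inv_mul (g h : FreeGroup α) : ℓ (g⁻¹ * h) + 2 * gromovProduct g h = ℓ g + ℓ h := by
  have := norm_mk_inv_mul_mk (isReduced_toWord (x := g)) (isReduced_toWord (x := h))
  rwa [mk_toWord, mk_toWord] at this

theorem gromovProduct_comm (g h : FreeGroup α) : gromovProduct g h = gromovProduct h g :=
  commonPrefixLength_comm _ _

theorem min_gromovProduct_le (g k h : FreeGroup α) :
    min (gromovProduct g k) (gromovProduct k h) ≤ gromovProduct g h :=
  min_commonPrefixLength_le _ _ _

theorem exists_mul_eq_gromovProduct (g h : FreeGroup α) :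
    ∃ a g' h', g = a * g' ∧ h = a * h' ∧ ℓ a = gromovProduct g h ∧
      ℓ g = ℓ a + ℓ g' ∧ ℓ h = ℓ a + ℓ h' := by
  obtain ⟨p, l, m, hg, hh, hp⟩ := exists_append_commonPrefixLength g.toWord h.toWord
  have hpl : IsReduced (p ++ l) := hg ▸ isReduced_toWord
  have hpm : IsReduced (p ++ m) := hh ▸ isReduced_toWord
  have hnorm : ∀ k, IsReduced (p ++ k) → (p ++ k).length = ℓ (mk p) + ℓ (mk k) := fun k hk => by
    rw [norm_mk_of_isReduced (hk.infix ⟨[], k, by simp⟩),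
      norm_mk_of_isReduced (hk.infix ⟨p, [], by simp⟩), List.length_append]
  refine ⟨mk p, mk l, mk m, ?_, ?_, ?_, ?_, ?_⟩
  · rw [mul_mk, ← hg, mk_toWord]
  · rw [mul_mk, ← hh, mk_toWord]
  · rw [norm_mk_of_isReduced (hpl.infix ⟨[], l, by simp⟩), hp, gromovProduct]
  · rw [← hnorm l hpl, ← hg, FreeGroup.norm]
  · rw [← hnorm m hpm, ← hh, FreeGroup.norm]

theorem gromovProduct_mul_self {a g : FreeGroup α} (h : ℓ (a * g) = ℓ a + ℓ g) :
    gromovProduct a (a * g) = ℓ a := by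
  have := norm_inv_mul a (a * g)
  rw [inv_mul_cancel_left] at this
  omega

theorem left_eq_of_mul_eq_mul {a b c d : FreeGroup α} (h : a * b = c * d)
    (hab : ℓ (a * b) = ℓ a + ℓ b) (hcd : ℓ (c * d) = ℓ c + ℓ d) (hac : ℓ a = ℓ c) : a = c := by
  have h1 := gromovProduct_mul_self hab
  have h2 := gromovProduct_mul_self hcd
  rw [gromovProduct_comm, ← h] at h2
  have hmin := min_gromovProduct_le a (a * b) c
  have hnorm := norm_inv_mul a c
  exact inv_mul_eq_one.1 (norm_eq_zero.1 (by omega))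

theorem norm_pow_succ (g : FreeGroup α) (n : ℕ) :
    ℓ (g ^ (n + 1)) = (n + 1) * (reduceCyclically g.toWord).length
      + 2 * (reduceCyclically.conjugator g.toWord).length := by
  rw [FreeGroup.norm, toWord_pow, reduceCyclically.reduce_flatten_replicate_succ isReduced_toWord]
  simp only [List.length_append, List.length_flatten, List.map_replicate, List.sum_replicate,
    invRev_length, smul_eq_mul]
  ring

theorem norm_lt_norm_mul_self {g : FreeGroup α} (hg : g ≠ 1) : ℓ g < ℓ (g * g) := by
  have hcyc : reduceCyclically g.toWord ≠ [] := fun h => hg <| by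
    rw [← mk_toWord (x := g), ← reduceCyclically.conj_conjugator_reduceCyclically g.toWord, h,
      List.append_nil, ← mul_mk, ← inv_mk, mul_inv_cancel]
  have hpos := List.length_pos_iff.2 hcyc
  have h1 := norm_pow_succ g 0
  have h2 := norm_pow_succ g 1
  rw [zero_add, pow_one] at h1
  rw [one_add_one_eq_two, pow_two] at h2
  omega

theorem two_mul_gromovProduct_inv_lt {g : FreeGroup α} (hg : g ≠ 1) :
    2 * gromovProduct g⁻¹ g < ℓ g := by
  have := norm_inv_mul g⁻¹ g
  rw [inv_inv, norm_inv_eq] at this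
  have := norm_lt_norm_mul_self hg
  omega

end GromovProduct

/-! ### Nielsen reduction of generating pairs -/

section NielsenReduction

open FreeGroup

local notation "ℓ" => FreeGroup.norm

/-- The value at the pair `f` of a letter, a letter being an index together with a sign. -/
def letterVal {G : Type*} [Group G] (f : Fin 2 → G) (a : Fin 2 × Bool) : G :=
  cond a.2 (f a.1) (f a.1)⁻¹

theorem letterVal_flip {G : Type*} [Group G] (f : Fin 2 → G) (a : Fin 2 × Bool) :
    letterVal f (a.1, !a.2) = (letterVal f a)⁻¹ := by
  obtain ⟨i, _ | _⟩ := a <;> simp [letterVal]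

theorem lift_mk_eq_prod_letterVal {G : Type*} [Group G] (f : Fin 2 → G) (w : FreeGroup (Fin 2)) :
    FreeGroup.lift f w = (w.toWord.map (letterVal f)).prod := by
  conv_lhs => rw [← mk_toWord (x := w)]
  exact FreeGroup.lift_mk

theorem letter_eq_or_eq_flip {ι : Type*} {a b : ι × Bool} (h : a.1 = b.1) :
    a = b ∨ a = (b.1, !b.2) := by
  rcases eq_or_ne a.2 b.2 with hs | hs
  · exact .inl (Prod.ext h hs)
  · exact .inr (Prod.ext h (Bool.eq_not_of_ne hs))

variable {α : Type*} [DecidableEq α]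

/-- The condition, of Nielsen's theory, that no letter is absorbed by its neighbours in a reduced
word in the two elements `f 0` and `f 1`. -/
def NoAbsorption (f : Fin 2 → FreeGroup α) : Prop :=
  ∀ a b c : Fin 2 × Bool, a ≠ b → c ≠ (b.1, !b.2) →
    gromovProduct (letterVal f a) (letterVal f b) + gromovProduct (letterVal f b)⁻¹ (letterVal f c)
      < ℓ (letterVal f b)

theorem NoAbsorption.length_add_le_norm {f : Fin 2 → FreeGroup α} (hf : NoAbsorption f)
    {a : Fin 2 × Bool} {L : List (Fin 2 × Bool)} (hL : IsReduced (a :: L)) {b : Fin 2 × Bool}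
    (hb : b ≠ a) :
    gromovProduct ((a :: L).map (letterVal f)).prod (letterVal f b)
        = gromovProduct (letterVal f a) (letterVal f b) ∧
      (a :: L).length + gromovProduct (letterVal f a) (letterVal f b)
        ≤ ℓ ((a :: L).map (letterVal f)).prod := by
  induction L generalizing a b with
  | nil =>
    have := hf b a a hb (by simp [Prod.ext_iff])
    rw [gromovProduct_comm] at this
    simp only [List.map_cons, List.map_nil, List.prod_singleton, List.length_singleton, true_and]
    omega
  | cons a' L ih =>
    have ha' : a' ≠ (a.1, !a.2) := by
      rintro rfl
      simpa using (isReduced_cons_cons.1 hL).1 rfl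
    obtain ⟨ih_gromov, ih_norm⟩ := ih (isReduced_cons_cons.1 hL).2 ha'.symm
    have key := hf b a a' hb ha'
    rw [letterVal_flip, gromovProduct_comm (letterVal f a')] at ih_gromov ih_norm
    rw [List.map_cons, List.prod_cons]
    set g := ((a' :: L).map (letterVal f)).prod
    set s := letterVal f a
    set t := letterVal f b
    have norm_mul : ℓ (s * g) + 2 * gromovProduct g s⁻¹ = ℓ s + ℓ g := by
      simpa [gromovProduct_comm] using norm_inv_mul s⁻¹ g
    have norm_cancel : ℓ g + 2 * gromovProduct s (s * g) = ℓ s + ℓ (s * g) := by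
      simpa using norm_inv_mul s (s * g)
    have le_gromov := min_gromovProduct_le (s * g) s t
    have gromov_le := min_gromovProduct_le s (s * g) t
    rw [gromovProduct_comm (s * g) s] at le_gromov
    rw [gromovProduct_comm t] at key
    simp only [List.length_cons] at ih_norm ⊢
    constructor <;> omega

theorem NoAbsorption.exists_letterVal_eq {f : Fin 2 → FreeGroup α} (hf : NoAbsorption f)
    (hsurj : Function.Surjective (FreeGroup.lift f)) {g : FreeGroup α} (hg : ℓ g = 1) :
    ∃ a, letterVal f a = g := by
  obtain ⟨w, rfl⟩ := hsurj g
  have hred : IsReduced w.toWord := isReduced_toWord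
  rw [lift_mk_eq_prod_letterVal] at hg ⊢
  match w.toWord, hred, hg with
  | [], _, hg => simp at hg
  | a :: L, hred, hg =>
    have hlen := (hf.length_add_le_norm hred (b := (a.1, !a.2)) (by simp [Prod.ext_iff])).2
    rw [hg, List.length_cons] at hlen
    have hL : L = [] := List.length_eq_zero_iff.1 (by omega)
    exact ⟨a, by simp [hL]⟩

/-- A set of pairs closed under Nielsen moves and simultaneous conjugation. -/
structure NielsenClosed {G : Type*} [Group G] (P : G → G → Prop) : Prop where
  swap {a b : G} : P a b → P b a
  inv {a b : G} : P a b → P a⁻¹ b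
  mul {a b : G} : P a b → P (a * b) b
  conj {a b : G} (g : G) : P a b → P (g * a * g⁻¹) (g * b * g⁻¹)

theorem NielsenClosed.inv_mul {G : Type*} [Group G] {P : G → G → Prop} (hP : NielsenClosed P)
    {a b : G} (h : P a b) : P (b⁻¹ * a) b := by
  simpa using hP.inv (hP.mul (hP.inv h))

/-- A pair in `P` of minimal total length. -/
def IsMinimalPair (P : FreeGroup α → FreeGroup α → Prop) (a b : FreeGroup α) : Prop :=
  P a b ∧ ∀ c d, P c d → ℓ a + ℓ b ≤ ℓ c + ℓ d

theorem exists_isMinimalPair {P : FreeGroup α → FreeGroup α → Prop} (hP : ∃ a b, P a b) :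
    ∃ a b, IsMinimalPair P a b := by
  obtain ⟨a, b, hab⟩ := hP
  obtain ⟨⟨c, d⟩, hcd, hmin⟩ :=
    (measure fun s : FreeGroup α × FreeGroup α => ℓ s.1 + ℓ s.2).wf.has_min
      {s | P s.1 s.2} ⟨(a, b), hab⟩
  exact ⟨c, d, hcd, fun c' d' h => not_lt.1 (hmin (c', d') h)⟩

namespace IsMinimalPair

variable {P : FreeGroup α → FreeGroup α → Prop} {a b : FreeGroup α}

theorem swap (hP : NielsenClosed P) (h : IsMinimalPair P a b) : IsMinimalPair P b a :=
  ⟨hP.swap h.1, fun c d hcd => by rw [add_comm]; exact h.2 c d hcd⟩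

theorem inv_left (hP : NielsenClosed P) (h : IsMinimalPair P a b) : IsMinimalPair P a⁻¹ b :=
  ⟨hP.inv h.1, fun c d hcd => by rw [norm_inv_eq]; exact h.2 c d hcd⟩

theorem inv_right (hP : NielsenClosed P) (h : IsMinimalPair P a b) : IsMinimalPair P a b⁻¹ :=
  ((h.swap hP).inv_left hP).swap hP

theorem letters (hP : NielsenClosed P) (h : IsMinimalPair P a b) {s t : Fin 2 × Bool}
    (hst : s.1 ≠ t.1) : IsMinimalPair P (letterVal ![a, b] s) (letterVal ![a, b] t) := by
  obtain ⟨i, σ⟩ := s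
  obtain ⟨j, τ⟩ := t
  have hsign {c d : FreeGroup α} (hcd : IsMinimalPair P c d) :
      IsMinimalPair P (cond σ c c⁻¹) (cond τ d d⁻¹) := by
    cases σ <;> cases τ
    exacts [(hcd.inv_left hP).inv_right hP, hcd.inv_left hP, hcd.inv_right hP, hcd]
  fin_cases i <;> fin_cases j
  exacts [absurd rfl hst, hsign h, hsign (h.swap hP), absurd rfl hst]

theorem two_mul_gromovProduct_le (hP : NielsenClosed P) (h : IsMinimalPair P a b) :
    2 * gromovProduct a b ≤ ℓ b := by
  have hmin := h.2 _ _ (hP.inv_mul h.1)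
  have hnorm := norm_inv_mul b a
  rw [gromovProduct_comm] at hnorm
  omega

-- Otherwise `b = r * s⁻¹` and `a = r * c * s⁻¹` without cancellation, with `r` and `s` of the same
-- length, and conjugating `(b⁻¹ * a, b)` by `s⁻¹` gives the shorter pair `(c, s⁻¹ * r)`.
theorem gromovProduct_add_gromovProduct_inv_lt (hP : NielsenClosed P) (h : IsMinimalPair P a b)
    (hb : b ≠ 1) : gromovProduct a b + gromovProduct a⁻¹ b⁻¹ < ℓ b := by
  have hba := (h.swap hP).two_mul_gromovProduct_le hP
  have hab := h.two_mul_gromovProduct_le hP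
  have hab_inv := ((h.inv_left hP).inv_right hP).two_mul_gromovProduct_le hP
  rw [gromovProduct_comm] at hba
  rw [norm_inv_eq] at hab_inv
  have hb_norm : ℓ b ≠ 0 := fun h0 => hb (norm_eq_zero.1 h0)
  by_contra! habsorbed
  obtain ⟨r, a₁, b₁, rfl, hb₁, hr, hna, hnb⟩ := exists_mul_eq_gromovProduct a b
  obtain ⟨s, a₂, b₂, ha₂, hb₂, hs, hna', hnb'⟩ := exists_mul_eq_gromovProduct (r * a₁)⁻¹ b⁻¹
  have hb₂' : b = b₂⁻¹ * s⁻¹ := by rw [← mul_inv_rev, ← hb₂, inv_inv]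
  rw [norm_inv_eq] at hna' hnb'
  have hr_eq : r = b₂⁻¹ := by
    refine left_eq_of_mul_eq_mul (hb₁.symm.trans hb₂') (hb₁ ▸ hnb) ?_ ?_
    · rw [← hb₂', norm_inv_eq, norm_inv_eq, hnb', add_comm]
    · rw [norm_inv_eq]; omega
  have hshort := h.2 _ _ (hP.conj s⁻¹ (hP.inv_mul h.1))
  have hconj_left : s⁻¹ * (b⁻¹ * (r * a₁)) * s⁻¹⁻¹ = a₁ * s := by rw [hb₂', hr_eq]; group
  have hconj_right : s⁻¹ * b * s⁻¹⁻¹ = s⁻¹ * r := by rw [hb₂', hr_eq]; group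
  rw [hconj_left, hconj_right] at hshort
  have hnorm_left : ℓ (a₁ * s) + 2 * ℓ s ≤ ℓ a₁ + ℓ s := by
    have h1 : gromovProduct a₁⁻¹ (r * a₁)⁻¹ = ℓ a₁ := by
      rw [mul_inv_rev, gromovProduct_mul_self, norm_inv_eq]
      rw [← mul_inv_rev, norm_inv_eq, norm_inv_eq, norm_inv_eq, hna, add_comm]
    have h2 : gromovProduct s (r * a₁)⁻¹ = ℓ s := by
      rw [ha₂, gromovProduct_mul_self]
      rw [← ha₂, norm_inv_eq, hna']
    have hmin := min_gromovProduct_le a₁⁻¹ (r * a₁)⁻¹ s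
    have hnorm := norm_inv_mul a₁⁻¹ s
    rw [gromovProduct_comm (r * a₁)⁻¹] at hmin
    rw [inv_inv, norm_inv_eq] at hnorm
    omega
  have hnorm_right : ℓ (s⁻¹ * r) ≤ ℓ s + ℓ r := by
    simpa only [norm_inv_eq] using norm_mul_le s⁻¹ r
  omega

theorem noAbsorption (hP : NielsenClosed P) (hne : ∀ {c d}, P c d → c ≠ 1)
    (h : IsMinimalPair P a b) : NoAbsorption ![a, b] := by
  intro s t u hst hut
  have hpair {v w : Fin 2 × Bool} (hvw : v.1 ≠ w.1) := h.letters hP hvw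
  set f := ![a, b]
  have ht : letterVal f t ≠ 1 := by
    obtain ⟨i, hi⟩ := exists_ne t.1
    exact hne (hpair (w := (i, true)) hi.symm).1
  have hself := two_mul_gromovProduct_inv_lt ht
  have hleft (hs : s.1 ≠ t.1) := (hpair hs).two_mul_gromovProduct_le hP
  have hright (hu : u.1 ≠ t.1) := ((hpair hu).inv_right hP).two_mul_gromovProduct_le hP
  rw [norm_inv_eq, gromovProduct_comm] at hright
  by_cases hs : s.1 = t.1
  · rw [(letter_eq_or_eq_flip hs).resolve_left hst, letterVal_flip]
    by_cases hu : u.1 = t.1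
    · rw [(letter_eq_or_eq_flip hu).resolve_right hut]
      omega
    · have := hright hu
      omega
  · by_cases hu : u.1 = t.1
    · rw [(letter_eq_or_eq_flip hu).resolve_right hut]
      have := hleft hs
      omega
    · have hus : u.1 = s.1 := by omega
      rcases letter_eq_or_eq_flip hus with rfl | rfl
      · have := min_gromovProduct_le (letterVal f t)⁻¹ (letterVal f u) (letterVal f t)
        have := hleft hs
        have := hright hu
        omega
      · rw [letterVal_flip, gromovProduct_comm (letterVal f t)⁻¹]
        exact (hpair hs).gromovProduct_add_gromovProduct_inv_lt hP ht

end IsMinimalPair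

theorem NielsenClosed.standard_basis {P : F → F → Prop} (hP : NielsenClosed P)
    (hgen : ∀ {a b}, P a b → Function.Surjective (FreeGroup.lift ![a, b]))
    (hne : ∀ {a b}, P a b → a ≠ 1) (hex : ∃ a b, P a b) : P x y := by
  obtain ⟨a, b, hab⟩ := exists_isMinimalPair hex
  have hf := hab.noAbsorption hP hne
  obtain ⟨s, hs⟩ := hf.exists_letterVal_eq (hgen hab.1) (g := x) (norm_of _)
  obtain ⟨t, ht⟩ := hf.exists_letterVal_eq (hgen hab.1) (g := y) (norm_of _)
  have hst : s.1 ≠ t.1 := fun h => by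
    have hxy : x = y ∨ x = y⁻¹ := by
      rw [← hs, ← ht]
      rcases letter_eq_or_eq_flip h with rfl | rfl
      · exact .inl rfl
      · exact .inr (letterVal_flip _ _)
    revert hxy
    decide
  rw [← hs, ← ht]
  exact (hab.letters hP hst).1

end NielsenReduction

/-! ### Nielsen generators of `Aut F` -/

theorem mulAut_ext {σ τ : MulAut F} (hx : σ x = τ x) (hy : σ y = τ y) : σ = τ := by
  have : σ.toMonoidHom = τ.toMonoidHom := by
    refine FreeGroup.ext_hom _ _ fun i => ?_
    fin_cases i
    · exact hx
    · exact hy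
  ext g
  exact DFunLike.congr_fun this g

@[simp] theorem alpha_x : alpha x = x := by simp [alpha, x]
@[simp] theorem alpha_y : alpha y = y * x ^ 2 := by simp [alpha, y]
@[simp] theorem beta_x : beta x = x * y ^ 2 := by simp [beta, x]
@[simp] theorem beta_y : beta y = y := by simp [beta, y]
@[simp] theorem alpha_symm_x : alpha.symm x = x := by
  rw [MulEquiv.symm_apply_eq, alpha_x]
@[simp] theorem alpha_symm_y : alpha.symm y = y * (x ^ 2)⁻¹ := by
  rw [MulEquiv.symm_apply_eq]; simp
@[simp] theorem beta_symm_x : beta.symm x = x * (y ^ 2)⁻¹ := by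
  rw [MulEquiv.symm_apply_eq]; simp
@[simp] theorem beta_symm_y : beta.symm y = y := by
  rw [MulEquiv.symm_apply_eq, beta_y]

/-- The automorphism exchanging `x` and `y`. -/
def swapAut : MulAut F :=
  MonoidHom.toMulEquiv (FreeGroup.lift ![y, x]) (FreeGroup.lift ![y, x])
    (by
      refine FreeGroup.ext_hom _ _ fun i => ?_
      fin_cases i <;> simp [x, y])
    (by
      refine FreeGroup.ext_hom _ _ fun i => ?_
      fin_cases i <;> simp [x, y])

@[simp] theorem swapAut_x : swapAut x = y := by simp [swapAut, x]
@[simp] theorem swapAut_y : swapAut y = x := by simp [swapAut, y]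

/-- The automorphism `x ↦ x y`, `y ↦ y`. -/
def transvAut : MulAut F :=
  MonoidHom.toMulEquiv (FreeGroup.lift ![x * y, y]) (FreeGroup.lift ![x * y⁻¹, y])
    (by
      refine FreeGroup.ext_hom _ _ fun i => ?_
      fin_cases i <;> simp [x, y])
    (by
      refine FreeGroup.ext_hom _ _ fun i => ?_
      fin_cases i <;> simp [x, y])

@[simp] theorem transvAut_x : transvAut x = x * y := by simp [transvAut, x]
@[simp] theorem transvAut_y : transvAut y = y := by simp [transvAut, y]

/-- The automorphisms raising each generator to the power `±1`. -/
def signAut : (Fin 2 → ℤˣ) →* MulAut F where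
  toFun s := MonoidHom.toMulEquiv (FreeGroup.lift fun i => FreeGroup.of i ^ (s i : ℤ))
    (FreeGroup.lift fun i => FreeGroup.of i ^ (s i : ℤ))
    (by
      refine FreeGroup.ext_hom _ _ fun i => ?_
      rcases Int.units_eq_one_or (s i) with h | h <;> simp [h])
    (by
      refine FreeGroup.ext_hom _ _ fun i => ?_
      rcases Int.units_eq_one_or (s i) with h | h <;> simp [h])
  map_one' := by
    refine mulAut_ext ?_ ?_ <;> simp [x, y]
  map_mul' s t := by
    refine mulAut_ext ?_ ?_ <;>
      simp [x, y, zpow_mul]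

@[simp] theorem signAut_x (s : Fin 2 → ℤˣ) : signAut s x = x ^ (s 0 : ℤ) := by simp [signAut, x]
@[simp] theorem signAut_y (s : Fin 2 → ℤˣ) : signAut s y = y ^ (s 1 : ℤ) := by simp [signAut, y]

theorem eq_top_of_nielsen_mem {H : Subgroup (MulAut F)} (hInt : intF ≤ H) (hswap : swapAut ∈ H)
    (hsign : signAut ![-1, 1] ∈ H) (htransv : transvAut ∈ H) : H = ⊤ := by
  rw [eq_top_iff]
  intro σ _
  let P : F → F → Prop := fun a b => ∃ h ∈ H, (σ * h) x = a ∧ (σ * h) y = b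
  have hP : NielsenClosed P := by
    refine ⟨?_, ?_, ?_, ?_⟩
    · rintro _ _ ⟨h, hh, rfl, rfl⟩
      exact ⟨h * swapAut, mul_mem hh hswap, by simp, by simp⟩
    · rintro _ _ ⟨h, hh, rfl, rfl⟩
      exact ⟨h * signAut ![-1, 1], mul_mem hh hsign, by simp, by simp⟩
    · rintro _ _ ⟨h, hh, rfl, rfl⟩
      exact ⟨h * transvAut, mul_mem hh htransv, by simp, by simp⟩
    · rintro _ _ g ⟨h, hh, rfl, rfl⟩
      exact ⟨MulAut.conj (σ⁻¹ g) * h, mul_mem (hInt ⟨_, rfl⟩) hh, by simp, by simp⟩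
  obtain ⟨h, hh, hx, hy⟩ : P x y := by
    refine hP.standard_basis ?_ ?_ ⟨_, _, 1, one_mem H, rfl, rfl⟩
    · rintro _ _ ⟨h, -, rfl, rfl⟩
      have hlift : FreeGroup.lift ![(σ * h) x, (σ * h) y] = (σ * h).toMonoidHom := by
        refine FreeGroup.ext_hom _ _ fun i => ?_
        fin_cases i <;> simp [x, y]
      rw [hlift]
      exact (σ * h).surjective
    · rintro _ _ ⟨h, -, rfl, rfl⟩ h1
      exact FreeGroup.of_ne_one 0 ((EmbeddingLike.map_eq_one_iff (f := σ * h)).1 h1)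
  rw [eq_inv_of_mul_eq_one_left (mulAut_ext hx hy : σ * h = 1)]
  exact inv_mem hh

/-! ### Automorphisms trivial modulo two -/

instance intF_normal : intF.Normal := by
  refine ⟨?_⟩
  rintro _ ⟨g, rfl⟩ σ
  exact ⟨σ g, MulEquiv.ext fun h => by simp⟩

theorem alpha_mem_range_nu0 : alpha ∈ nu0.range := ⟨FreeGroup.of 0, by simp [nu0]⟩

theorem beta_mem_range_nu0 : beta ∈ nu0.range := ⟨FreeGroup.of 1, by simp [nu0]⟩

theorem range_nu0_le {K : Subgroup (MulAut F)} (ha : alpha ∈ K) (hb : beta ∈ K) :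
    nu0.range ≤ K := by
  rw [nu0, FreeGroup.range_lift_eq_closure, Subgroup.closure_le]
  rintro _ ⟨i, rfl⟩
  fin_cases i <;> assumption

/-- `Int F · ν₀(Φ)`. -/
def intNu : Subgroup (MulAut F) := intF ⊔ nu0.range

theorem intF_le_intNu : intF ≤ intNu := le_sup_left

theorem alpha_mem_intNu : alpha ∈ intNu := Subgroup.mem_sup_right alpha_mem_range_nu0

theorem beta_mem_intNu : beta ∈ intNu := Subgroup.mem_sup_right beta_mem_range_nu0

theorem mem_intNu {σ : MulAut F} : σ ∈ intNu ↔ ∃ g r, σ = MulAut.conj g * nu0 r := by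
  rw [intNu, Subgroup.mem_sup_of_normal_left]
  constructor
  · rintro ⟨_, ⟨g, rfl⟩, _, ⟨r, rfl⟩, rfl⟩
    exact ⟨g, r, rfl⟩
  · rintro ⟨g, r, rfl⟩
    exact ⟨_, ⟨g, rfl⟩, _, ⟨r, rfl⟩, rfl⟩

theorem conj_mem_of_mem_intNu {K : Subgroup (MulAut F)} (hi : intF ≤ K) {g : MulAut F}
    (ha : g * alpha * g⁻¹ ∈ K) (hb : g * beta * g⁻¹ ∈ K) {σ : MulAut F} (hσ : σ ∈ intNu) :
    g * σ * g⁻¹ ∈ K := by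
  have hle : intNu ≤ K.comap (MulAut.conj g).toMonoidHom :=
    sup_le (fun τ hτ => hi (intF_normal.conj_mem τ hτ g)) (range_nu0_le ha hb)
  exact hle hσ

theorem signAut_mul_alpha (s : Fin 2 → ℤˣ) :
    ∃ (g : F) (e : ℤ), signAut s * alpha = MulAut.conj g * alpha ^ e * signAut s := by
  rcases Int.units_eq_one_or (s 0) with h0 | h0 <;> rcases Int.units_eq_one_or (s 1) with h1 | h1
  · refine ⟨1, 1, mulAut_ext ?_ ?_⟩ <;> simp [h0, h1]
  · refine ⟨(x * x)⁻¹, -1, mulAut_ext (by simp [h0]) (by simp [h0, h1, pow_two]; group)⟩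
  · refine ⟨1, -1, mulAut_ext ?_ ?_⟩ <;> simp [h0, h1]
  · refine ⟨x * x, 1, mulAut_ext (by simp [h0]) (by simp [h0, h1]; group)⟩

theorem signAut_mul_beta (s : Fin 2 → ℤˣ) :
    ∃ (g : F) (e : ℤ), signAut s * beta = MulAut.conj g * beta ^ e * signAut s := by
  rcases Int.units_eq_one_or (s 0) with h0 | h0 <;> rcases Int.units_eq_one_or (s 1) with h1 | h1
  · refine ⟨1, 1, mulAut_ext ?_ ?_⟩ <;> simp [h0, h1]
  · refine ⟨1, -1, mulAut_ext ?_ ?_⟩ <;> simp [h0, h1]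
  · refine ⟨(y * y)⁻¹, -1, mulAut_ext (by simp [h0, h1, pow_two]; group) (by simp [h1])⟩
  · refine ⟨y * y, 1, mulAut_ext (by simp [h0, h1]; group) (by simp [h1])⟩

theorem signAut_conj_mem_intNu (s : Fin 2 → ℤˣ) {σ : MulAut F} (hσ : σ ∈ intNu) :
    signAut s * σ * (signAut s)⁻¹ ∈ intNu := by
  refine conj_mem_of_mem_intNu intF_le_intNu ?_ ?_ hσ
  · obtain ⟨g, e, h⟩ := signAut_mul_alpha s
    rw [h, mul_inv_cancel_right]
    exact mul_mem (intF_le_intNu ⟨g, rfl⟩) (zpow_mem alpha_mem_intNu e)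
  · obtain ⟨g, e, h⟩ := signAut_mul_beta s
    rw [h, mul_inv_cancel_right]
    exact mul_mem (intF_le_intNu ⟨g, rfl⟩) (zpow_mem beta_mem_intNu e)

/-- The automorphisms of `F` acting trivially on `F/F²[F,F]`, described by generators: the inner
automorphisms, `ν₀(Φ)` and the sign changes. -/
def evenAut : Subgroup (MulAut F) := intNu ⊔ signAut.range

theorem intNu_le_evenAut : intNu ≤ evenAut := le_sup_left

theorem intF_le_evenAut : intF ≤ evenAut := intF_le_intNu.trans intNu_le_evenAut

theorem alpha_mem_evenAut : alpha ∈ evenAut := intNu_le_evenAut alpha_mem_intNu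

theorem beta_mem_evenAut : beta ∈ evenAut := intNu_le_evenAut beta_mem_intNu

theorem signAut_mem_evenAut (s : Fin 2 → ℤˣ) : signAut s ∈ evenAut :=
  Subgroup.mem_sup_right ⟨s, rfl⟩

theorem exists_intNu_mul_signAut {σ : MulAut F} (hσ : σ ∈ evenAut) :
    ∃ τ ∈ intNu, ∃ s, σ = τ * signAut s := by
  rw [evenAut, Subgroup.sup_eq_closure] at hσ
  induction hσ using Subgroup.closure_induction with
  | mem σ h =>
    rcases h with h | ⟨s, rfl⟩
    · exact ⟨σ, h, 1, by simp⟩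
    · exact ⟨1, one_mem _, s, by simp⟩
  | one => exact ⟨1, one_mem _, 1, by simp⟩
  | mul σ₁ σ₂ _ _ h₁ h₂ =>
    obtain ⟨τ₁, h₁, s₁, rfl⟩ := h₁
    obtain ⟨τ₂, h₂, s₂, rfl⟩ := h₂
    refine ⟨τ₁ * (signAut s₁ * τ₂ * (signAut s₁)⁻¹), mul_mem h₁ (signAut_conj_mem_intNu _ h₂),
      s₁ * s₂, ?_⟩
    rw [map_mul]; group
  | inv σ _ h =>
    obtain ⟨τ, h, s, rfl⟩ := h
    refine ⟨_, signAut_conj_mem_intNu s⁻¹ (inv_mem h), s⁻¹, ?_⟩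
    rw [map_inv]; group

theorem swapAut_mul_self : swapAut * swapAut = 1 := by
  refine mulAut_ext ?_ ?_ <;> simp

theorem transvAut_mul_self : transvAut * transvAut = beta := by
  refine mulAut_ext ?_ ?_ <;> simp [pow_two, mul_assoc]

theorem transvAut_mul_alpha : transvAut * alpha =
    MulAut.conj (y⁻¹ * x⁻¹) * beta * alpha⁻¹ * signAut ![-1, -1] * transvAut := by
  refine mulAut_ext ?_ ?_ <;> simp [pow_two, mul_assoc]

theorem transvAut_mul_signAut (s : Fin 2 → ℤˣ) :
    ∃ τ ∈ intNu, transvAut * signAut s = τ * signAut s * transvAut := by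
  rcases Int.units_eq_one_or (s 0) with h0 | h0 <;> rcases Int.units_eq_one_or (s 1) with h1 | h1
  · refine ⟨1, one_mem _, mulAut_ext ?_ ?_⟩ <;> simp [h0, h1]
  · refine ⟨beta, beta_mem_intNu, mulAut_ext ?_ ?_⟩ <;>
      simp [h0, h1, pow_two, mul_assoc]
  · refine ⟨MulAut.conj y * beta, mul_mem (intF_le_intNu ⟨_, rfl⟩) beta_mem_intNu,
      mulAut_ext (by simp [h0, h1]; group) (by simp [h1])⟩
  · refine ⟨MulAut.conj y⁻¹, intF_le_intNu ⟨_, rfl⟩,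
      mulAut_ext (by simp [h0, h1]; group) (by simp [h1])⟩

theorem braid_relation : transvAut * swapAut * transvAut =
    MulAut.conj y * beta * signAut ![1, -1] * (swapAut * transvAut * swapAut) :=
  mulAut_ext (by simp; group) (by simp; group)

theorem conj_mem_evenAut {g : MulAut F} (ha : g * alpha * g⁻¹ ∈ evenAut)
    (hb : g * beta * g⁻¹ ∈ evenAut) (hs : ∀ s, g * signAut s * g⁻¹ ∈ evenAut) {σ : MulAut F}
    (hσ : σ ∈ evenAut) : g * σ * g⁻¹ ∈ evenAut := by
  have hle : evenAut ≤ evenAut.comap (MulAut.conj g).toMonoidHom := by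
    refine sup_le (fun τ hτ => conj_mem_of_mem_intNu intF_le_evenAut ha hb hτ) ?_
    rintro _ ⟨s, rfl⟩
    exact hs s
  exact hle hσ

theorem swapAut_conj_mem_evenAut {σ : MulAut F} (hσ : σ ∈ evenAut) :
    swapAut * σ * swapAut⁻¹ ∈ evenAut := by
  refine conj_mem_evenAut ?_ ?_ (fun s => ?_) hσ
  · have h : swapAut * alpha * swapAut⁻¹ = beta :=
      mul_inv_eq_iff_eq_mul.2 (mulAut_ext (by simp) (by simp))
    exact h ▸ beta_mem_evenAut
  · have h : swapAut * beta * swapAut⁻¹ = alpha :=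
      mul_inv_eq_iff_eq_mul.2 (mulAut_ext (by simp) (by simp))
    exact h ▸ alpha_mem_evenAut
  · have h : swapAut * signAut s * swapAut⁻¹ = signAut ![s 1, s 0] :=
      mul_inv_eq_iff_eq_mul.2 (mulAut_ext (by simp) (by simp))
    exact h ▸ signAut_mem_evenAut _

theorem transvAut_conj_mem_evenAut {σ : MulAut F} (hσ : σ ∈ evenAut) :
    transvAut * σ * transvAut⁻¹ ∈ evenAut := by
  refine conj_mem_evenAut ?_ ?_ (fun s => ?_) hσ
  · rw [transvAut_mul_alpha, mul_inv_cancel_right]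
    exact mul_mem (mul_mem (mul_mem (intF_le_evenAut ⟨_, rfl⟩) beta_mem_evenAut)
      (inv_mem alpha_mem_evenAut)) (signAut_mem_evenAut _)
  · rw [← transvAut_mul_self, mul_assoc, mul_assoc, mul_inv_cancel, mul_one, transvAut_mul_self]
    exact beta_mem_evenAut
  · obtain ⟨τ, hτ, h⟩ := transvAut_mul_signAut s
    rw [h, mul_inv_cancel_right]
    exact mul_mem (intNu_le_evenAut hτ) (signAut_mem_evenAut _)

theorem mem_normalizer_of_sq_mem {G : Type*} [Group G] {H : Subgroup G} {g : G}
    (h : ∀ a ∈ H, g * a * g⁻¹ ∈ H) (hg : g * g ∈ H) : g ∈ Subgroup.normalizer (H : Set G) := by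
  rw [Subgroup.mem_normalizer_iff]
  intro a
  refine ⟨h a, fun ha => ?_⟩
  have h1 := h _ ha
  have : g * (g * a * g⁻¹) * g⁻¹ = (g * g) * a * (g * g)⁻¹ := by group
  rw [this] at h1
  rwa [Subgroup.mul_mem_cancel_right _ (inv_mem hg), Subgroup.mul_mem_cancel_left _ hg] at h1

instance evenAut_normal : evenAut.Normal := by
  rw [← Subgroup.normalizer_eq_top_iff]
  refine eq_top_of_nielsen_mem (intF_le_evenAut.trans Subgroup.le_normalizer)
    (mem_normalizer_of_sq_mem (fun _ => swapAut_conj_mem_evenAut) ?_)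
    (Subgroup.le_normalizer (signAut_mem_evenAut _))
    (mem_normalizer_of_sq_mem (fun _ => transvAut_conj_mem_evenAut) ?_)
  · exact swapAut_mul_self ▸ one_mem _
  · exact transvAut_mul_self ▸ beta_mem_evenAut

theorem mem_of_mem_closure_of_braid {G : Type*} [Group G] {s t : G} (hs : s * s = 1)
    (ht : t * t = 1) (hst : t * s * t = s * t * s) {g : G} (hg : g ∈ Subgroup.closure {s, t}) :
    g ∈ ({1, s, t, s * t, t * s, s * t * s} : Set G) := by
  have hs_inv : s⁻¹ = s := inv_eq_of_mul_eq_one_left hs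
  have ht_inv : t⁻¹ = t := inv_eq_of_mul_eq_one_left ht
  have hstst : s * (t * (s * t)) = t * s := by
    rw [← mul_assoc t, hst, mul_assoc, ← mul_assoc, hs, one_mul]
  have hmul : ∀ g ∈ ({1, s, t, s * t, t * s, s * t * s} : Set G), ∀ u ∈ ({s, t} : Set G),
      g * u ∈ ({1, s, t, s * t, t * s, s * t * s} : Set G) := by
    rintro g (rfl | rfl | rfl | rfl | rfl | rfl) u (rfl | rfl) <;> simp_all [mul_assoc]
  induction hg using Subgroup.closure_induction_right with
  | one => exact .inl rfl
  | mul_right g _ u hu h => exact hmul g h u hu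
  | mul_inv_cancel g _ u hu h =>
    have hu_inv : u⁻¹ = u := by rcases hu with rfl | rfl <;> assumption
    rw [hu_inv]
    exact hmul g h u hu

theorem mk_mem_closure_swapAut_transvAut (σ : MulAut F) :
    (σ : MulAut F ⧸ evenAut) ∈ Subgroup.closure {(swapAut : MulAut F ⧸ evenAut), ↑transvAut} := by
  let π := QuotientGroup.mk' evenAut
  have hker {τ : MulAut F} (hτ : τ ∈ evenAut) : π τ = 1 := (QuotientGroup.eq_one_iff τ).2 hτ
  have htop : (Subgroup.closure {π swapAut, π transvAut}).comap π = ⊤ := by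
    refine eq_top_of_nielsen_mem (fun τ hτ => ?_) (Subgroup.subset_closure (.inl rfl)) ?_
      (Subgroup.subset_closure (.inr rfl))
    · rw [Subgroup.mem_comap, hker (intF_le_evenAut hτ)]
      exact one_mem _
    · rw [Subgroup.mem_comap, hker (signAut_mem_evenAut _)]
      exact one_mem _
  exact (Subgroup.eq_top_iff' _).1 htop σ

theorem exists_evenAut_mul (σ : MulAut F) :
    ∃ τ ∈ evenAut, ∃ w ∈ ({1, swapAut, transvAut, swapAut * transvAut, transvAut * swapAut,
      swapAut * transvAut * swapAut} : Set (MulAut F)), σ = τ * w := by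
  have hker {τ : MulAut F} (hτ : τ ∈ evenAut) : (τ : MulAut F ⧸ evenAut) = 1 :=
    (QuotientGroup.eq_one_iff τ).2 hτ
  have hbraid : (transvAut * swapAut * transvAut : MulAut F ⧸ evenAut)
      = swapAut * transvAut * swapAut := by
    simp only [← QuotientGroup.mk_mul]
    rw [braid_relation, QuotientGroup.mk_mul, hker, one_mul]
    exact mul_mem (mul_mem (intF_le_evenAut ⟨_, rfl⟩) beta_mem_evenAut) (signAut_mem_evenAut _)
  have hsix := mem_of_mem_closure_of_braid
    (by rw [← QuotientGroup.mk_mul, swapAut_mul_self, QuotientGroup.mk_one])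
    (by rw [← QuotientGroup.mk_mul, transvAut_mul_self, hker beta_mem_evenAut]) hbraid
    (mk_mem_closure_swapAut_transvAut σ)
  have hlift : ∀ w : MulAut F, (σ : MulAut F ⧸ evenAut) = w → ∃ τ ∈ evenAut, σ = τ * w := by
    intro w h
    refine ⟨σ * w⁻¹, ?_, by group⟩
    rw [← QuotientGroup.eq_one_iff, QuotientGroup.mk_mul, QuotientGroup.mk_inv, h, mul_inv_cancel]
  simp only [← QuotientGroup.mk_mul, ← QuotientGroup.mk_one] at hsix
  rcases hsix with h | h | h | h | h | h <;> obtain ⟨τ, hτ, hσ⟩ := hlift _ h <;>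
    exact ⟨τ, hτ, _, by simp, hσ⟩

/-! ### Action on the abelianization -/

theorem abMatrix_mul (σ τ : MulAut F) : abMatrix (σ * τ) = abMatrix σ * abMatrix τ :=
  congrArg Units.val (map_mul theta σ τ)

theorem abMatrix_conj (g : F) : abMatrix (MulAut.conj g) = 1 := by
  ext i j
  fin_cases i <;> fin_cases j <;> simp [abMatrix, expSum, mul_comm]

theorem abMatrix_signAut (s : Fin 2 → ℤˣ) :
    abMatrix (signAut s) = !![(s 0 : ℤ), 0; 0, (s 1 : ℤ)] := by
  ext i j
  fin_cases i <;> fin_cases j <;> simp [abMatrix, expSum, signAut]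

theorem abMatrix_alpha : abMatrix alpha = !![1, 2; 0, 1] := by
  ext i j
  fin_cases i <;> fin_cases j <;> simp [abMatrix, expSum, alpha, x, y]

theorem abMatrix_alpha_inv : abMatrix alpha⁻¹ = !![1, -2; 0, 1] := by
  have h0 : alpha.symm (FreeGroup.of 0) = _ := alpha_symm_x
  have h1 : alpha.symm (FreeGroup.of 1) = _ := alpha_symm_y
  ext i j
  fin_cases i <;> fin_cases j <;> simp [abMatrix, expSum, h0, h1] <;> simp [x, y]

theorem abMatrix_beta : abMatrix beta = !![1, 0; 2, 1] := by
  ext i j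
  fin_cases i <;> fin_cases j <;> simp [abMatrix, expSum, beta, x, y]

theorem abMatrix_beta_inv : abMatrix beta⁻¹ = !![1, 0; -2, 1] := by
  have h0 : beta.symm (FreeGroup.of 0) = _ := beta_symm_x
  have h1 : beta.symm (FreeGroup.of 1) = _ := beta_symm_y
  ext i j
  fin_cases i <;> fin_cases j <;> simp [abMatrix, expSum, h0, h1] <;> simp [x, y]

theorem abMatrix_swapAut : abMatrix swapAut = !![0, 1; 1, 0] := by
  ext i j
  fin_cases i <;> fin_cases j <;> simp [abMatrix, expSum, swapAut, x, y]

theorem abMatrix_transvAut : abMatrix transvAut = !![1, 0; 1, 1] := by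
  ext i j
  fin_cases i <;> fin_cases j <;> simp [abMatrix, expSum, transvAut, x, y]

/-- The congruence conditions that cut out Sanov's subgroup `SL′₂(ℤ)` of `SL₂(ℤ)`: diagonal entries
`≡ 1` modulo `4` and even off-diagonal entries. -/
def IsSanov (A : Matrix (Fin 2) (Fin 2) ℤ) : Prop :=
  4 ∣ A 0 0 - 1 ∧ 4 ∣ A 1 1 - 1 ∧ 2 ∣ A 0 1 ∧ 2 ∣ A 1 0

theorem IsSanov.mul {A B : Matrix (Fin 2) (Fin 2) ℤ} (hA : IsSanov A) (hB : IsSanov B) :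
    IsSanov (A * B) := by
  obtain ⟨⟨a, ha⟩, ⟨b, hb⟩, ⟨c, hc⟩, ⟨d, hd⟩⟩ := hA
  obtain ⟨⟨a', ha'⟩, ⟨b', hb'⟩, ⟨c', hc'⟩, ⟨d', hd'⟩⟩ := hB
  rw [sub_eq_iff_eq_add] at ha hb ha' hb'
  simp only [IsSanov, Matrix.mul_apply, Fin.sum_univ_two, ha, hb, hc, hd, ha', hb', hc', hd']
  exact ⟨⟨4 * a * a' + a + a' + c * d', by ring⟩, ⟨4 * b * b' + b + b' + d * c', by ring⟩,
    ⟨4 * a * c' + c' + 4 * c * b' + c, by ring⟩, ⟨4 * d * a' + d + 4 * b * d' + d', by ring⟩⟩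

theorem isSanov_nu0 (r : Phi) : IsSanov (abMatrix (nu0 r)) := by
  have h : ∀ i : Fin 2, IsSanov (abMatrix (nu0 (FreeGroup.of i))) ∧
      IsSanov (abMatrix (nu0 (FreeGroup.of i)⁻¹)) := by
    intro i
    have ha : nu0 (FreeGroup.of 0) = alpha := by simp [nu0]
    have hb : nu0 (FreeGroup.of 1) = beta := by simp [nu0]
    fin_cases i
    · simp only [Fin.zero_eta, map_inv, ha, abMatrix_alpha, abMatrix_alpha_inv]
      simp [IsSanov]
    · simp only [Fin.mk_one, map_inv, hb, abMatrix_beta, abMatrix_beta_inv]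
      simp [IsSanov]
  induction r using FreeGroup.induction_on with
  | C1 =>
    have : abMatrix 1 = 1 := congrArg Units.val (map_one theta)
    rw [map_one, this]
    simp [IsSanov]
  | of i => exact (h i).1
  | inv_of i _ => exact (h i).2
  | mul r s hr hs => rw [map_mul, abMatrix_mul]; exact hr.mul hs

theorem isSanov_of_mem_intNu {σ : MulAut F} (hσ : σ ∈ intNu) : IsSanov (abMatrix σ) := by
  obtain ⟨g, r, rfl⟩ := mem_intNu.1 hσ
  rw [abMatrix_mul, abMatrix_conj, one_mul]
  exact isSanov_nu0 r

theorem mem_evenAut_of_two_dvd {σ : MulAut F} (h01 : 2 ∣ abMatrix σ 0 1)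
    (h10 : 2 ∣ abMatrix σ 1 0) : σ ∈ evenAut := by
  obtain ⟨τ, hτ, w, hw, rfl⟩ := exists_evenAut_mul σ
  obtain ⟨ρ, hρ, s, rfl⟩ := exists_intNu_mul_signAut hτ
  obtain ⟨⟨a, ha⟩, ⟨b, hb⟩, ⟨c, hc⟩, ⟨d, hd⟩⟩ := isSanov_of_mem_intNu hρ
  rw [sub_eq_iff_eq_add] at ha hb
  rcases hw with rfl | rfl | rfl | rfl | rfl | rfl
  · rwa [mul_one]
  all_goals
    exfalso
    simp only [abMatrix_mul, abMatrix_signAut, abMatrix_swapAut, abMatrix_transvAut,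
      Matrix.mul_apply, Fin.sum_univ_two, ha, hb, hc, hd] at h01 h10
    rcases Int.units_eq_one_or (s 0) with h0 | h0 <;>
      rcases Int.units_eq_one_or (s 1) with h1 | h1 <;> simp [h0, h1] at h01 h10 <;>
      omega

theorem mem_intNu_of_isSanov {σ : MulAut F} (hσ : IsSanov (abMatrix σ)) : σ ∈ intNu := by
  obtain ⟨h00, h11, h01, h10⟩ := hσ
  obtain ⟨ρ, hρ, s, rfl⟩ := exists_intNu_mul_signAut (mem_evenAut_of_two_dvd h01 h10)
  obtain ⟨⟨a, ha⟩, ⟨b, hb⟩, -, -⟩ := isSanov_of_mem_intNu hρ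
  rw [sub_eq_iff_eq_add] at ha hb
  simp only [abMatrix_mul, abMatrix_signAut, Matrix.mul_apply, Fin.sum_univ_two, ha, hb] at h00 h11
  have eq_one {ε : ℤˣ} {a : ℤ} (h : 4 ∣ (4 * a + 1) * ε - 1) : ε = 1 := by
    rcases Int.units_eq_one_or ε with rfl | rfl
    · rfl
    · simp only [Units.val_neg, Units.val_one] at h
      omega
  have hs : s = 1 := by
    ext i
    fin_cases i
    · simp [eq_one (ε := s 0) (a := a) (by simpa using h00)]
    · simp [eq_one (ε := s 1) (a := b) (by simpa using h11)]
  rwa [hs, map_one, mul_one]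

theorem range_nu0_le_autPrime : nu0.range ≤ autPrime := by
  refine range_nu0_le ⟨_, Subgroup.subset_closure (Or.inl rfl), ?_⟩
    ⟨_, Subgroup.subset_closure (Or.inr rfl), ?_⟩
  · exact Units.ext abMatrix_alpha.symm
  · exact Units.ext abMatrix_beta.symm

/-! ### The subgroups `H^k[H,H]` -/

section PowComm

variable {G G' : Type*} [Group G] [Group G'] {k : ℕ} {H K : Subgroup G}

theorem powComm_le_iff : powComm k H ≤ K ↔ (∀ h ∈ H, h ^ k ∈ K) ∧ ⁅H, H⁆ ≤ K := by
  simp only [powComm, sup_le_iff, Subgroup.closure_le, Set.image_subset_iff]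
  rfl

theorem pow_mem_powComm {h : G} (hh : h ∈ H) : h ^ k ∈ powComm k H :=
  (powComm_le_iff.1 le_rfl).1 h hh

theorem commutator_le_powComm (k : ℕ) (H : Subgroup G) : ⁅H, H⁆ ≤ powComm k H := le_sup_right

theorem commutator_mem_powComm {a b : G} (ha : a ∈ H) (hb : b ∈ H) : ⁅a, b⁆ ∈ powComm k H :=
  commutator_le_powComm k H (Subgroup.commutator_mem_commutator ha hb)

theorem powComm_le (k : ℕ) (H : Subgroup G) : powComm k H ≤ H :=
  powComm_le_iff.2 ⟨fun _ hh => pow_mem hh k, Subgroup.commutator_le_self H⟩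

theorem powComm_mono (h : H ≤ K) : powComm k H ≤ powComm k K :=
  powComm_le_iff.2 ⟨fun _ hh => pow_mem_powComm (h hh),
    (Subgroup.commutator_mono h h).trans (commutator_le_powComm k K)⟩

theorem powComm_le_of_dvd {l : ℕ} (h : k ∣ l) (H : Subgroup G) : powComm l H ≤ powComm k H := by
  obtain ⟨j, rfl⟩ := h
  refine powComm_le_iff.2 ⟨fun g hg => ?_, commutator_le_powComm k H⟩
  rw [pow_mul]
  exact pow_mem (pow_mem_powComm hg) j

theorem map_powComm (f : G →* G') : (powComm k H).map f = powComm k (H.map f) := by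
  rw [powComm, powComm, Subgroup.map_sup, Subgroup.map_commutator, MonoidHom.map_closure]
  congr 2
  ext
  simp

theorem map_mem_powComm {H' : Subgroup G'} {f : G →* G'} (hf : H.map f ≤ H') {u : G}
    (hu : u ∈ powComm k H) : f u ∈ powComm k H' :=
  powComm_mono hf (map_powComm f ▸ Subgroup.mem_map_of_mem f hu)

theorem powComm_normal (k : ℕ) (H : Subgroup G) [H.Normal] : (powComm k H).Normal :=
  ⟨fun _ hu g => map_mem_powComm (f := (MulAut.conj g).toMonoidHom)
    (Subgroup.map_le_iff_le_comap.2 fun h hh => Subgroup.Normal.conj_mem ‹_› h hh g) hu⟩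

end PowComm

/-! ### Cocycles with values in functions on a quotient -/

/-- A crossed homomorphism from `H` to the group of functions `Q → A`, on which `H` acts through
`π` by left translation. -/
def IsCocycle {H Q A : Type*} [Group H] [Group Q] [AddCommGroup A] (π : H →* Q)
    (C : H → Q → A) : Prop :=
  ∀ v w h, C (v * w) h = C v h + C w ((π v)⁻¹ * h)

theorem exists_isCocycle {α Q A : Type*} [Group Q] [AddCommGroup A] (π : FreeGroup α →* Q)
    (f : α → Q → A) :
    ∃ C : FreeGroup α → Q → A, IsCocycle π C ∧ ∀ i, C (FreeGroup.of i) = f i := by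
  let Θ : FreeGroup α →* (Q → Multiplicative A) ⋊[mulAutArrow] Q :=
    FreeGroup.lift fun i => ⟨fun h => Multiplicative.ofAdd (f i h), π (FreeGroup.of i)⟩
  have hright (w : FreeGroup α) : (Θ w).right = π w := by
    have : SemidirectProduct.rightHom.comp Θ = π := FreeGroup.ext_hom _ _ fun i => by simp [Θ]
    exact DFunLike.congr_fun this w
  refine ⟨fun w h => ((Θ w).left h).toAdd, fun v w h => ?_, fun i => by funext; simp [Θ]⟩
  simp only [map_mul, SemidirectProduct.mul_left, Pi.mul_apply, toAdd_mul, hright]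
  rfl

theorem sum_sub_translate {Q A : Type*} [Group Q] [AddCommGroup A] (O : Subgroup Q) [Fintype O]
    (E : Q → A) {z : Q} (hz : z ∈ O) : ∑ o : O, (E o - E (z⁻¹ * o)) = 0 := by
  rw [Finset.sum_sub_distrib, sub_eq_zero]
  exact (Fintype.sum_equiv (Equiv.mulLeft (⟨z, hz⟩ : O)⁻¹) _ _ fun o => by simp).symm

namespace IsCocycle

variable {H Q A : Type*} [Group H] [Group Q] [AddCommGroup A] {π : H →* Q} {C : H → Q → A}

theorem apply_mul (hC : IsCocycle π C) (v w : H) (h : Q) :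
    C (v * w) h = C v h + C w ((π v)⁻¹ * h) :=
  hC v w h

theorem apply_one (hC : IsCocycle π C) : C 1 = 0 := by
  funext h
  simpa using hC 1 1 h

theorem apply_inv (hC : IsCocycle π C) (w : H) (h : Q) : C w⁻¹ h = -C w (π w * h) := by
  have := hC w⁻¹ w h
  rw [inv_mul_cancel, hC.apply_one, map_inv, inv_inv] at this
  exact eq_neg_of_add_eq_zero_left this.symm

theorem apply_pow_of_mem_ker (hC : IsCocycle π C) {t : H} (ht : t ∈ π.ker) (n : ℕ) :
    C (t ^ n) = n • C t := by
  rw [MonoidHom.mem_ker] at ht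
  funext h
  induction n with
  | zero => simp [hC.apply_one]
  | succ n ih => simp [pow_succ, hC.apply_mul, ih, ht, succ_nsmul]

theorem apply_commutator (hC : IsCocycle π C) (v w : H) (h : Q) :
    C ⁅v, w⁆ h = C v h + C w ((π v)⁻¹ * h) - C v (π (v * w⁻¹ * v⁻¹) * h)
      - C w (π ⁅w, v⁆ * h) := by
  simp only [commutatorElement_def, hC.apply_mul, hC.apply_inv, map_mul, map_inv, inv_inv,
    mul_assoc]
  abel

theorem eq_zero_of_mem_powComm (hC : IsCocycle π C) {q : ℕ} (hA : ∀ a : A, q • a = 0) {u : H}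
    (hu : u ∈ powComm q π.ker) : C u = 0 := by
  let K : Subgroup H :=
    { carrier := {w | π w = 1 ∧ C w = 0}
      one_mem' := ⟨map_one π, hC.apply_one⟩
      mul_mem' := fun {v w} ⟨hv, hCv⟩ ⟨hw, hCw⟩ =>
        ⟨by rw [map_mul, hv, hw, one_mul], by funext h; rw [hC, hCv, hCw]; simp⟩
      inv_mem' := fun {w} ⟨hw, hCw⟩ =>
        ⟨by rw [map_inv, hw, inv_one], by funext h; rw [hC.apply_inv, hCw]; simp⟩ }
  have hK : powComm q π.ker ≤ K := by
    refine powComm_le_iff.2 ⟨fun t ht => ⟨pow_mem ht q, ?_⟩, Subgroup.commutator_le.2 ?_⟩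
    · funext h
      simp [hC.apply_pow_of_mem_ker ht, hA]
    · intro a ha b hb
      rw [MonoidHom.mem_ker] at ha hb
      refine ⟨by simp [commutatorElement_def, ha, hb], ?_⟩
      funext h
      rw [hC.apply_commutator]
      simp [commutatorElement_def, ha, hb]
  exact (hK hu).2

theorem sub_eq_sub_of_commutator_mem (hC : IsCocycle π C) {q : ℕ} (hA : ∀ a : A, q • a = 0)
    {g w : H} (hu : ⁅g, w⁆ ∈ powComm q π.ker) (h : Q) :
    C g h - C g ((π w)⁻¹ * h) = C w h - C w ((π g)⁻¹ * h) := by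
  have hπ : π ⁅g, w⁆ = 1 := powComm_le q _ hu
  have hgw : C (g * w) h = C (w * g) h := by
    rw [show g * w = ⁅g, w⁆ * (w * g) by simp [commutatorElement_def, mul_assoc], hC,
      hC.eq_zero_of_mem_powComm hA hu, hπ]
    simp
  rw [hC, hC] at hgw
  rw [sub_eq_sub_iff_add_eq_add, hgw, add_comm]

theorem sum_zpowers_sub_eq_zero (hC : IsCocycle π C) {q : ℕ} (hA : ∀ a : A, q • a = 0) {g w : H}
    (hu : ⁅g, w⁆ ∈ powComm q π.ker) [Fintype (Subgroup.zpowers (π w))] :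
    ∑ o : Subgroup.zpowers (π w), (C w o - C w ((π g)⁻¹ * o)) = 0 := by
  rw [← sum_sub_translate (Subgroup.zpowers (π w)) (C g) (Subgroup.mem_zpowers (π w))]
  exact Finset.sum_congr rfl fun o _ => (hC.sub_eq_sub_of_commutator_mem hA hu o).symm

theorem apply_zpowers_mul (hC : IsCocycle π C) {q : ℕ} (hA : ∀ a : A, q • a = 0) {g w : H}
    (hu : ⁅g, w⁆ ∈ powComm q π.ker) (hw : C w = 0) {k : Q} (hk : k ∈ Subgroup.zpowers (π w))
    (h : Q) : C g (k * h) = C g h := by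
  rw [Subgroup.zpowers_eq_closure] at hk
  induction hk using Subgroup.closure_induction generalizing h with
  | mem k hk =>
    rw [Set.mem_singleton_iff.1 hk]
    simpa [hw, sub_eq_zero] using hC.sub_eq_sub_of_commutator_mem hA hu (π w * h)
  | one => rw [one_mul]
  | mul a b _ _ ha hb => rw [mul_assoc, ha, hb]
  | inv a _ ha => rw [← ha, mul_inv_cancel_left]

end IsCocycle

/-- The number of `o` in the subgroup `O` with `o = u`, minus the number of those with
`k⁻¹ * o = u`. -/
noncomputable def cosetDiff {Q : Type*} [Group Q] (A : Type*) [AddGroupWithOne A] (O : Subgroup Q)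
    (k u : Q) : A :=
  (O : Set Q).indicator 1 u - (O : Set Q).indicator 1 (k * u)

theorem sum_single_eq_indicator {Q A : Type*} [Group Q] [DecidableEq Q] [AddCommMonoidWithOne A]
    (O : Subgroup Q) [Fintype O] (u : Q) :
    ∑ o : O, (Pi.single u 1 : Q → A) o = (O : Set Q).indicator 1 u := by
  by_cases h : u ∈ O
  · rw [Set.indicator_of_mem h, Fintype.sum_eq_single ⟨u, h⟩]
    · simp
    · exact fun o ho => Pi.single_eq_of_ne (fun e => ho (Subtype.ext e)) _
  · rw [Set.indicator_of_notMem h]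
    exact Finset.sum_eq_zero fun o _ => Pi.single_eq_of_ne (fun e : (o : Q) = u => h (e ▸ o.2)) _

theorem sum_single_sub_single_eq_cosetDiff {Q A : Type*} [Group Q] [DecidableEq Q]
    [AddCommGroupWithOne A] (O : Subgroup Q) [Fintype O] (k u : Q) :
    ∑ o : O, ((Pi.single u 1 : Q → A) o - (Pi.single u 1 : Q → A) (k⁻¹ * o)) =
      cosetDiff A O k u := by
  have htranslate (o : O) :
      (Pi.single u 1 : Q → A) (k⁻¹ * o) = (Pi.single (k * u) 1 : Q → A) o := by
    simp [Pi.single_apply, inv_mul_eq_iff_eq_mul]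
  simp only [Finset.sum_sub_distrib, htranslate, sum_single_eq_indicator, cosetDiff]

theorem IsCocycle.cosetDiff_eq {H Q A : Type*} [Group H] [Group Q] [DecidableEq Q]
    [AddCommGroupWithOne A] {π : H →* Q} {C : H → Q → A} (hC : IsCocycle π C) {q : ℕ}
    (hA : ∀ a : A, q • a = 0) {g w : H} (hu : ⁅g, w⁆ ∈ powComm q π.ker)
    [Finite (Subgroup.zpowers (π w))] {a b : Q} (hw : C w = Pi.single a 1 - Pi.single b 1) :
    cosetDiff A (Subgroup.zpowers (π w)) (π g) a =
      cosetDiff A (Subgroup.zpowers (π w)) (π g) b := by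
  have := Fintype.ofFinite (Subgroup.zpowers (π w))
  rw [← sub_eq_zero, ← hC.sum_zpowers_sub_eq_zero hA hu, hw, ← sum_single_sub_single_eq_cosetDiff,
    ← sum_single_sub_single_eq_cosetDiff, ← Finset.sum_sub_distrib]
  refine Finset.sum_congr rfl fun o _ => ?_
  simp only [Pi.sub_apply]
  abel

theorem nsmul_zmod_eq_zero {q : ℕ} (a : ZMod q) : q • a = 0 := by simp

/-! ### Centralizers modulo `T^q[T,T]` in free groups -/

section Centralizer

variable {α Q : Type*} [Group Q] [Finite Q] {q : ℕ}

theorem map_mem_zpowers_of_commutator_mem (hq : q ≠ 1) {π : FreeGroup α →* Q} {d : FreeGroup α}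
    {i : α} (hd : ⁅d, FreeGroup.of i⁆ ∈ powComm q π.ker) :
    π d ∈ Subgroup.zpowers (π (FreeGroup.of i)) := by
  classical
  have := Fintype.ofFinite (Subgroup.zpowers (π (FreeGroup.of i)))
  have : Nontrivial (ZMod q) := ZMod.nontrivial_iff.2 hq
  obtain ⟨C, hC, hCof⟩ := exists_isCocycle (A := ZMod q) π fun _ => Pi.single 1 1
  have hsum := hC.sum_zpowers_sub_eq_zero nsmul_zmod_eq_zero hd
  rw [hCof, sum_single_sub_single_eq_cosetDiff, cosetDiff] at hsum
  by_contra hdO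
  simp [Set.indicator_of_notMem hdO] at hsum

theorem mem_ker_of_forall_commutator_mem [Nontrivial α] (hq : 2 < q) {π : FreeGroup α →* Q}
    {d : FreeGroup α} (hd : ∀ w, ⁅d, w⁆ ∈ powComm q π.ker) : d ∈ π.ker := by
  classical
  have : Fact (2 < q) := ⟨hq⟩
  obtain ⟨i, j, hij⟩ := exists_pair_ne α
  obtain ⟨C, hC, hCof⟩ := exists_isCocycle (A := ZMod q) π (Pi.single j (Pi.single 1 1))
  have hCi : C (FreeGroup.of i) = 0 := by rw [hCof, Pi.single_eq_of_ne hij]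
  have hCj : C (FreeGroup.of j) = Pi.single 1 1 := by rw [hCof, Pi.single_eq_same]
  have hinv (h : Q) : C d (π d * h) = C d h :=
    hC.apply_zpowers_mul nsmul_zmod_eq_zero (hd _) hCi
      (map_mem_zpowers_of_commutator_mem (by omega) (hd _)) h
  have hcomm : (π (FreeGroup.of j))⁻¹ * π d = π d * (π (FreeGroup.of j))⁻¹ := by
    have : π ⁅d, FreeGroup.of j⁆ = 1 := powComm_le q _ (hd _)
    rw [map_commutatorElement, commutatorElement_eq_one_iff_mul_comm] at this
    rw [inv_mul_eq_iff_eq_mul, ← mul_assoc, ← this, mul_inv_cancel_right]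
  have heq : (Pi.single 1 1 : Q → ZMod q) 1 - (Pi.single 1 1 : Q → ZMod q) (π d)⁻¹ =
      (Pi.single 1 1 : Q → ZMod q) (π d) - (Pi.single 1 1 : Q → ZMod q) 1 := by
    have hone := hC.sub_eq_sub_of_commutator_mem nsmul_zmod_eq_zero (hd (FreeGroup.of j)) 1
    have hmap := hC.sub_eq_sub_of_commutator_mem nsmul_zmod_eq_zero (hd (FreeGroup.of j)) (π d)
    rw [hcomm, hinv, ← mul_one (π d), hinv] at hmap
    simp only [mul_one, hCj, inv_mul_cancel] at hone hmap
    rw [← hone, hmap]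
  by_contra hdker
  have hne : π d ≠ 1 := hdker
  refine ZMod.neg_one_ne_one (n := q) ?_
  simpa [hne, eq_comm] using heq

theorem cosetDiff_mul_eq {π : F →* Q} {g : F} (hg : ⁅g, ⁅y, x⁆⁆ ∈ powComm q π.ker) (w : F) (u : Q) :
    cosetDiff (ZMod q) (Subgroup.zpowers (π ⁅y, x⁆)) (π g) (π w * u) =
      cosetDiff (ZMod q) (Subgroup.zpowers (π ⁅y, x⁆)) (π g) u := by
  classical
  set D := cosetDiff (ZMod q) (Subgroup.zpowers (π ⁅y, x⁆)) (π g)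
  have hconj (u : Q) : D (π (y * x * y⁻¹) * u) = D u := by
    obtain ⟨C, hC, hCof⟩ := exists_isCocycle (A := ZMod q) π ![0, Pi.single u 1]
    refine (hC.cosetDiff_eq nsmul_zmod_eq_zero hg ?_).symm
    funext h
    rw [hC.apply_commutator, show C x = 0 from hCof 0, show C y = Pi.single u 1 from hCof 1]
    simp [Pi.single_apply, ← eq_inv_mul_iff_mul_eq, mul_assoc]
  have hcomm (u : Q) : D (π ⁅y, x⁆ * u) = D (π y * u) := by
    obtain ⟨C, hC, hCof⟩ := exists_isCocycle (A := ZMod q) π ![Pi.single u 1, 0]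
    refine (hC.cosetDiff_eq nsmul_zmod_eq_zero hg ?_).symm
    funext h
    rw [hC.apply_commutator, show C x = Pi.single u 1 from hCof 0, show C y = 0 from hCof 1]
    simp [Pi.single_apply, ← eq_inv_mul_iff_mul_eq, mul_assoc, commutatorElement_def]
  let I : Subgroup F :=
    { carrier := {w | ∀ u, D (π w * u) = D u}
      one_mem' := fun u => by rw [map_one, one_mul]
      mul_mem' := fun {v w} hv hw u => by rw [map_mul, mul_assoc, hv, hw]
      inv_mem' := fun {w} hw u => by rw [← hw, map_inv, mul_inv_cancel_left] }
  have hyx : y * x ∈ I := fun u => by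
    calc D (π (y * x) * u) = D (π y * (π x * u)) := by rw [map_mul, mul_assoc]
      _ = D (π ⁅y, x⁆ * (π x * u)) := (hcomm _).symm
      _ = D (π (y * x * y⁻¹) * u) := by simp [commutatorElement_def, mul_assoc]
      _ = D u := hconj u
  have hy : y ∈ I := by
    simpa [mul_assoc] using mul_mem (inv_mem (show y * x * y⁻¹ ∈ I from hconj)) hyx
  have hx : x ∈ I := by simpa using mul_mem (inv_mem hy) hyx
  have hI : (⊤ : Subgroup F) ≤ I := by
    rw [← FreeGroup.closure_range_of, Subgroup.closure_le]
    rintro _ ⟨i, rfl⟩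
    fin_cases i
    exacts [hx, hy]
  exact hI (Subgroup.mem_top w) u

theorem map_mem_zpowers_commutator (hq : 2 < q) {π : F →* Q} {g : F}
    (hg : ⁅g, ⁅y, x⁆⁆ ∈ powComm q π.ker) : π g ∈ Subgroup.zpowers (π ⁅y, x⁆) := by
  have : Fact (2 < q) := ⟨hq⟩
  by_contra hgO
  have hgO' : π g⁻¹ ∉ Subgroup.zpowers (π ⁅y, x⁆) := by rwa [map_inv, inv_mem_iff]
  have h := cosetDiff_mul_eq hg g⁻¹ 1
  refine ZMod.neg_one_ne_one (n := q) ?_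
  rw [cosetDiff, cosetDiff, mul_one, mul_one, ← map_mul, mul_inv_cancel, map_one,
    Set.indicator_of_notMem hgO', Set.indicator_of_mem (one_mem (Subgroup.zpowers _)),
    Set.indicator_of_notMem hgO] at h
  simpa using h

end Centralizer

/-! ### The Schreier bound -/

section Schreier

variable {H Q V W : Type*} [Group H] [Group Q] [AddCommGroup V] [AddCommGroup W] {π : H →* Q}

theorem isCocycle_sub_translate (π : H →* Q) (e : Q → V) :
    IsCocycle π fun w h => e h - e ((π w)⁻¹ * h) := by
  intro v w h
  simp [mul_assoc]

theorem IsCocycle.prodMk {C : H → Q → V} {E : H → Q → W} (hC : IsCocycle π C)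
    (hE : IsCocycle π E) : IsCocycle π fun w h => (C w h, E w h) :=
  fun v w h => Prod.ext (hC v w h) (hE v w h)

theorem IsCocycle.apply_mem {α : Type*} {π : FreeGroup α →* Q} {C : FreeGroup α → Q → V}
    (hC : IsCocycle π C) {L : AddSubgroup V} (hL : ∀ i h, C (FreeGroup.of i) h ∈ L)
    (w : FreeGroup α) (h : Q) : C w h ∈ L := by
  induction w using FreeGroup.induction_on generalizing h with
  | C1 => rw [hC.apply_one]; exact zero_mem L
  | of i => exact hL i h
  | inv_of i ih => rw [hC.apply_inv]; exact neg_mem (ih _)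
  | mul a b ha hb => rw [hC.apply_mul]; exact add_mem (ha _) (hb _)

-- Shapiro's lemma: `C` is the image of `χ` under corestriction along the section `r`.
theorem exists_isCocycle_eq_on_ker (hπ : Function.Surjective π) (χ : π.ker →* Multiplicative V) :
    ∃ C : H → Q → V, IsCocycle π C ∧ ∀ t : π.ker, C t 1 = (χ t).toAdd := by
  classical
  obtain ⟨r, hr, hr1⟩ : ∃ r : Q → H, (∀ h, π (r h) = h) ∧ r 1 = 1 := by
    refine ⟨Function.update (Function.surjInv hπ) 1 1, fun h => ?_, Function.update_self ..⟩
    obtain rfl | hh := eq_or_ne h 1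
    · simp
    · rw [Function.update_of_ne hh, Function.surjInv_eq hπ]
  have hmem (w : H) (h : Q) : (r h)⁻¹ * w * r ((π w)⁻¹ * h) ∈ π.ker := by
    simp [MonoidHom.mem_ker, hr]
  refine ⟨fun w h => (χ ⟨_, hmem w h⟩).toAdd, fun v w h => ?_, fun t => ?_⟩
  · rw [← toAdd_mul, ← map_mul]
    exact congrArg (fun t => (χ t).toAdd) (Subtype.ext (by simp [mul_assoc]))
  · exact congrArg (fun t => (χ t).toAdd) (Subtype.ext (by simp [hr1, show π t = 1 from t.2]))

theorem card_mul_pow_dvd_of_surjective {α R : Type*} [Finite α] [Finite Q] [Ring R] [Module R V]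
    {π : FreeGroup α →* Q} (hπ : Function.Surjective π) {χ : π.ker →* Multiplicative V}
    (hχ : Function.Surjective χ) :
    Nat.card V * Nat.card R ^ (Nat.card Q - 1) ∣ Nat.card R ^ (Nat.card α * Nat.card Q) := by
  classical
  have := Fintype.ofFinite Q
  have := Fintype.ofFinite α
  obtain ⟨C, hC, hCker⟩ := exists_isCocycle_eq_on_ker hπ χ
  let e : Q → {k : Q // k ≠ 1} → R := fun h k => (Pi.single h 1 : Q → R) k
  have hK := hC.prodMk (isCocycle_sub_translate π e)
  set K := fun (w : FreeGroup α) h => (C w h, e h - e ((π w)⁻¹ * h))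
  let L := Fintype.linearCombination R fun s : α × Q => K (FreeGroup.of s.1) s.2
  have hrange (w : FreeGroup α) (h : Q) : K w h ∈ LinearMap.range L :=
    hK.apply_mem (L := (LinearMap.range L).toAddSubgroup)
      (fun i h => ⟨Pi.single (i, h) 1, by simp [L, Fintype.linearCombination_apply_single]⟩) w h
  have hfst (v : V) : (v, 0) ∈ LinearMap.range L := by
    obtain ⟨t, ht⟩ := hχ (Multiplicative.ofAdd v)
    simpa [K, hCker, ht, show π t = 1 from t.2] using hrange t 1
  have hsingle (k : {k : Q // k ≠ 1}) : ((0 : V), Pi.single k (1 : R)) ∈ LinearMap.range L := by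
    obtain ⟨w, hw⟩ := hπ k
    have hek : e k - e ((π w)⁻¹ * k) = Pi.single k 1 := by
      funext j
      simp [e, hw, Pi.single_apply, Subtype.ext_iff, j.2]
    simpa [K, hek] using sub_mem (hrange w k) (hfst (C w k))
  have hsurj : Function.Surjective L := by
    rw [← LinearMap.range_eq_top, eq_top_iff]
    rintro ⟨v, f⟩ -
    have hf : ((0 : V), f) = ∑ k, f k • ((0 : V), (Pi.single k 1 : {k : Q // k ≠ 1} → R)) := by
      refine Prod.ext (by simp [Prod.fst_sum]) ?_
      funext j
      simp [Prod.snd_sum, Pi.single_apply]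
    have hsum := sum_mem fun k (_ : k ∈ Finset.univ) => Submodule.smul_mem _ (f k) (hsingle k)
    rw [← hf] at hsum
    simpa using add_mem (hfst v) hsum
  have hcard := AddSubgroup.card_dvd_of_surjective L.toAddMonoidHom hsurj
  have hcompl : Fintype.card {k : Q // k ≠ 1} = Nat.card Q - 1 := by
    rw [Fintype.card_subtype_compl, Fintype.card_subtype_eq, Nat.card_eq_fintype_card]
  rwa [Nat.card_prod, Nat.card_fun, Nat.card_fun, Nat.card_eq_fintype_card (α := {k : Q // k ≠ 1}),
    hcompl, Nat.card_prod] at hcard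

theorem relIndex_powComm_ker_dvd {α : Type*} [Finite α] [Nonempty α] [Finite Q] (q : ℕ)
    {π : FreeGroup α →* Q} (hπ : Function.Surjective π) :
    (powComm q π.ker).relIndex π.ker ∣ q ^ ((Nat.card α - 1) * Nat.card Q + 1) := by
  obtain rfl | hq := eq_or_ne q 0
  · simp
  have := powComm_normal q π.ker
  let U := (powComm q π.ker).subgroupOf π.ker
  let : CommGroup (π.ker ⧸ U) :=
    { (inferInstance : Group (π.ker ⧸ U)) with
      mul_comm := by
        rintro ⟨a⟩ ⟨b⟩
        refine (QuotientGroup.eq (s := U)).2 ?_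
        rw [Subgroup.mem_subgroupOf]
        have := commutator_mem_powComm (k := q) (inv_mem b.2) (inv_mem a.2)
        simpa [commutatorElement_def, mul_assoc] using this }
  let : Module (ZMod q) (Additive (π.ker ⧸ U)) := AddCommGroup.zmodModule (by
    rintro ⟨a⟩
    refine (QuotientGroup.eq_one_iff (N := U) (a ^ q)).2 ?_
    rw [Subgroup.mem_subgroupOf]
    exact pow_mem_powComm a.2)
  have hcard : (powComm q π.ker).relIndex π.ker * q ^ (Nat.card Q - 1) ∣
      q ^ (Nat.card α * Nat.card Q) := by
    have := card_mul_pow_dvd_of_surjective (R := ZMod q) (V := Additive (π.ker ⧸ U)) hπ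
      (χ := QuotientGroup.mk' U) (QuotientGroup.mk'_surjective U)
    rwa [Nat.card_zmod] at this
  have hrank : Nat.card α * Nat.card Q =
      ((Nat.card α - 1) * Nat.card Q + 1) + (Nat.card Q - 1) := by
    obtain ⟨a, ha⟩ : ∃ a, Nat.card α = a + 1 := Nat.exists_eq_succ_of_ne_zero Nat.card_pos.ne'
    have : 0 < Nat.card Q := Nat.card_pos
    rw [ha, Nat.add_sub_cancel, Nat.succ_mul]
    omega
  rw [hrank, pow_add] at hcard
  exact Nat.dvd_of_mul_dvd_mul_right (pow_pos (Nat.pos_of_ne_zero hq) _) hcard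

theorem relIndex_powComm_dvd {α : Type*} [Finite α] [Nonempty α] (q : ℕ)
    (T : Subgroup (FreeGroup α)) [T.Normal] [T.FiniteIndex] :
    (powComm q T).relIndex T ∣ q ^ ((Nat.card α - 1) * T.index + 1) := by
  simpa only [QuotientGroup.ker_mk', T.index_eq_card] using
    relIndex_powComm_ker_dvd q (QuotientGroup.mk'_surjective T)

end Schreier

/-! ### The action of `Φ` on `Ψ` and on `F′` -/

section PsiHom

variable {G : Type*} [Group G]

/-- The homomorphism from the group of order two sending the generator to `g`. -/
def involutionHom (g : G) (hg : g * g = 1) : Multiplicative (ZMod 2) →* G :=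
  AddMonoidHom.toMultiplicativeLeft (ZMod.lift 2 ⟨zmultiplesHom (Additive G) (.ofMul g), by
    simpa [two_zsmul] using congrArg Additive.ofMul hg⟩)

@[simp] theorem involutionHom_ofAdd_one (g : G) (hg : g * g = 1) :
    involutionHom g hg (.ofAdd 1) = g := by
  have h := ZMod.lift_coe 2 ⟨zmultiplesHom (Additive G) (.ofMul g), by
    simpa [two_zsmul] using congrArg Additive.ofMul hg⟩ 1
  simpa [involutionHom] using congrArg Additive.toMul h

/-- The homomorphism `zᵢ ↦ gᵢ` from `Ψ` given by three involutions. -/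
def psiLift (g : Fin 3 → G) (hg : ∀ i, g i * g i = 1) : Psi →* G :=
  Monoid.CoprodI.lift fun i => involutionHom (g i) (hg i)

@[simp] theorem psiLift_z (g : Fin 3 → G) (hg : ∀ i, g i * g i = 1) (i : Fin 3) :
    psiLift g hg (z i) = g i := by
  rw [psiLift, z, Monoid.CoprodI.lift_of, involutionHom_ofAdd_one]

theorem closure_range_z : Subgroup.closure (Set.range z) = ⊤ := by
  refine eq_top_iff.2 fun w _ => ?_
  induction w using Monoid.CoprodI.induction_on with
  | one => exact one_mem _
  | of i a =>
    obtain ⟨a, rfl⟩ := Multiplicative.ofAdd.surjective a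
    fin_cases a
    · have h : (Monoid.CoprodI.of (i := i) (1 : Multiplicative (ZMod 2)) : Psi) = 1 := map_one _
      exact h ▸ one_mem _
    · exact Subgroup.subset_closure ⟨i, rfl⟩
  | mul a b ha hb => exact mul_mem (ha trivial) (hb trivial)

theorem psi_hom_ext {f g : Psi →* G} (h : ∀ i, f (z i) = g (z i)) : f = g :=
  MonoidHom.eq_of_eqOn_dense closure_range_z (Set.forall_mem_range.2 h)

@[simp] theorem z_mul_self (i : Fin 3) : z i * z i = 1 := by
  rw [z, ← map_mul, ← ofAdd_add, show (1 + 1 : ZMod 2) = 0 from rfl, ofAdd_zero, map_one]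

@[simp] theorem z_inv (i : Fin 3) : (z i)⁻¹ = z i := inv_eq_of_mul_eq_one_left (z_mul_self i)

@[simp] theorem z_mul_cancel (i : Fin 3) (w : Psi) : z i * (z i * w) = w := by
  rw [← mul_assoc, z_mul_self, one_mul]

theorem normal_of_conj_z_mem {H : Subgroup Psi} (h : ∀ i, ∀ a ∈ H, z i * a * z i ∈ H) :
    H.Normal := by
  rw [← Subgroup.normalizer_eq_top_iff, eq_top_iff, ← closure_range_z, Subgroup.closure_le]
  rintro _ ⟨i, rfl⟩
  rw [SetLike.mem_coe, Subgroup.mem_normalizer_iff, z_inv]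
  exact fun a => ⟨h i a, fun ha => by simpa [mul_assoc] using h i _ ha⟩

theorem inclF_x : inclF x = z 0 * z 1 := by simp [inclF, x]

theorem inclF_y : inclF y = z 1 * z 2 := by simp [inclF, y]

theorem psi_hom_ext_inclF {f g : Psi →* G} (hF : ∀ w, f (inclF w) = g (inclF w))
    (hz : f (z 1) = g (z 1)) : f = g := by
  have h0 : z 0 = inclF x * z 1 := by simp [inclF_x, mul_assoc]
  have h2 : z 2 = z 1 * inclF y := by simp [inclF_y]
  refine psi_hom_ext fun i => ?_
  fin_cases i
  · simp [h0, hF, hz]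
  · exact hz
  · simp [h2, hF, hz]

end PsiHom

/-- The extension of `α` to `Ψ`. -/
def alphaPsi : MulAut Psi :=
  MonoidHom.toMulEquiv
    (psiLift ![z 1 * z 0 * z 1, z 1 * z 0 * z 1 * z 0 * z 1,
        z 1 * z 0 * z 1 * z 0 * z 2 * z 0 * z 1 * z 0 * z 1]
      (fun i => by fin_cases i <;> simp [mul_assoc]))
    (psiLift ![z 0 * z 1 * z 0 * z 1 * z 0, z 0 * z 1 * z 0,
        z 0 * z 1 * z 0 * z 1 * z 2 * z 1 * z 0 * z 1 * z 0]
      (fun i => by fin_cases i <;> simp [mul_assoc]))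
    (psi_hom_ext fun i => by fin_cases i <;> simp [mul_assoc])
    (psi_hom_ext fun i => by fin_cases i <;> simp [mul_assoc])

/-- The extension of `β` to `Ψ`. -/
def betaPsi : MulAut Psi :=
  MonoidHom.toMulEquiv
    (psiLift ![z 0, z 2 * z 1 * z 2, z 2 * z 1 * z 2 * z 1 * z 2]
      (fun i => by fin_cases i <;> simp [mul_assoc]))
    (psiLift ![z 0, z 1 * z 2 * z 1 * z 2 * z 1, z 1 * z 2 * z 1]
      (fun i => by fin_cases i <;> simp [mul_assoc]))
    (psi_hom_ext fun i => by fin_cases i <;> simp [mul_assoc])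
    (psi_hom_ext fun i => by fin_cases i <;> simp [mul_assoc])

theorem alphaPsi_z (i : Fin 3) : alphaPsi (z i) =
    ![z 1 * z 0 * z 1, z 1 * z 0 * z 1 * z 0 * z 1,
        z 1 * z 0 * z 1 * z 0 * z 2 * z 0 * z 1 * z 0 * z 1] i := by
  simp [alphaPsi]

theorem betaPsi_z (i : Fin 3) :
    betaPsi (z i) = ![z 0, z 2 * z 1 * z 2, z 2 * z 1 * z 2 * z 1 * z 2] i := by
  simp [betaPsi]

/-- The action of `Φ` on `Ψ` extending `ν₀`. -/
def nuPsi : Phi →* MulAut Psi := FreeGroup.lift ![alphaPsi, betaPsi]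

/-- The restriction of `alphaPsi` to `F′`. -/
def alphaF' : MulAut (FreeGroup (Fin 3)) :=
  MonoidHom.toMulEquiv
    (FreeGroup.lift ![(.of 0 * .of 2)⁻¹ * .of 0 * (.of 0 * .of 2), .of 1,
      (.of 0 * .of 2)⁻¹ * .of 2 * (.of 0 * .of 2)])
    (FreeGroup.lift ![(.of 0 * .of 2) * .of 0 * (.of 0 * .of 2)⁻¹, .of 1,
      (.of 0 * .of 2) * .of 2 * (.of 0 * .of 2)⁻¹])
    (FreeGroup.ext_hom _ _ fun i => by fin_cases i <;> simp [mul_assoc])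
    (FreeGroup.ext_hom _ _ fun i => by fin_cases i <;> simp [mul_assoc])

/-- The restriction of `betaPsi` to `F′`. -/
def betaF' : MulAut (FreeGroup (Fin 3)) :=
  MonoidHom.toMulEquiv
    (FreeGroup.lift ![.of 0, .of 1, (.of 1 * .of 0)⁻¹ * .of 2 * (.of 1 * .of 0)])
    (FreeGroup.lift ![.of 0, .of 1, (.of 1 * .of 0) * .of 2 * (.of 1 * .of 0)⁻¹])
    (FreeGroup.ext_hom _ _ fun i => by fin_cases i <;> simp [mul_assoc])
    (FreeGroup.ext_hom _ _ fun i => by fin_cases i <;> simp [mul_assoc])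

/-- The action of `Φ` on `F′`. -/
def nuF' : Phi →* MulAut (FreeGroup (Fin 3)) := FreeGroup.lift ![alphaF', betaF']

theorem map_apply_of_generators {ι G H : Type*} [Group G] [Group H] (ν : FreeGroup ι →* MulAut G)
    (μ : FreeGroup ι →* MulAut H) (f : G →* H)
    (h : ∀ i, f.comp (ν (.of i)).toMonoidHom = (μ (.of i)).toMonoidHom.comp f)
    (r : FreeGroup ι) (g : G) : f (ν r g) = μ r (f g) := by
  induction r using FreeGroup.induction_on generalizing g with
  | C1 => simp
  | of i => exact DFunLike.congr_fun (h i) g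
  | inv_of i ih =>
    apply (μ (.of i)).injective
    rw [← ih, map_inv, map_inv, MulAut.apply_inv_self, MulAut.apply_inv_self]
  | mul a b ha hb => simp only [map_mul, MulAut.mul_apply, ha, hb]

theorem inclF_nu0 (r : Phi) (w : F) : inclF (nu0 r w) = nuPsi r (inclF w) := by
  refine map_apply_of_generators nu0 nuPsi inclF (fun a => FreeGroup.ext_hom _ _ fun i => ?_) r w
  fin_cases a <;> fin_cases i <;>
    simp [nu0, nuPsi, alpha, beta, x, y, inclF, alphaPsi_z, betaPsi_z, pow_two, mul_assoc]

theorem inclF'_nuF' (r : Phi) (f : FreeGroup (Fin 3)) :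
    inclF' (nuF' r f) = nuPsi r (inclF' f) := by
  refine map_apply_of_generators nuF' nuPsi inclF' (fun a => FreeGroup.ext_hom _ _ fun i => ?_) r f
  fin_cases a <;> fin_cases i <;>
    simp [nuF', nuPsi, alphaF', betaF', inclF', alphaPsi_z, betaPsi_z, mul_assoc]

theorem rho_nuF' (r : Phi) (f : FreeGroup (Fin 3)) :
    rho (nuF' r f) = phi r * rho f * (phi r)⁻¹ := by
  refine map_apply_of_generators nuF' (MulAut.conj.comp phi) rho
    (fun a => FreeGroup.ext_hom _ _ fun i => ?_) r f
  fin_cases a <;> fin_cases i <;> simp [nuF', alphaF', betaF', rho, phi, mul_assoc]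

theorem nu0_commutator (r : Phi) : nu0 r ⁅y, x⁆ = ⁅y, x⁆ := by
  have h : nu0.range ≤ MulAction.stabilizer (MulAut F) ⁅y, x⁆ := by
    refine range_nu0_le ?_ ?_ <;>
      simp [MulAction.mem_stabilizer_iff, commutatorElement_def, pow_two, mul_assoc]
  exact h ⟨r, rfl⟩

/-- The automorphism `x ↦ x⁻¹`, `y ↦ y⁻¹`, induced by conjugation by `z₂`. -/
def tau : MulAut F := signAut ![-1, -1]

@[simp] theorem tau_x : tau x = x⁻¹ := by simp [tau]

@[simp] theorem tau_y : tau y = y⁻¹ := by simp [tau]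

@[simp] theorem tau_tau (w : F) : tau (tau w) = w := by
  have h : tau * tau = 1 := mulAut_ext (by simp) (by simp)
  exact DFunLike.congr_fun h w

theorem inclF_tau (w : F) : inclF (tau w) = z 1 * inclF w * z 1 := by
  have h : inclF.comp tau.toMonoidHom = (MulAut.conj (z 1)).toMonoidHom.comp inclF := by
    refine FreeGroup.ext_hom _ _ fun i => ?_
    fin_cases i <;> simp [tau, signAut, inclF, mul_assoc]
  simpa using DFunLike.congr_fun h w

theorem inclF_injective : Function.Injective inclF := by
  -- `Ψ = F ⋊ ⟨z₂⟩` acts on `F`, with `F` acting by translations and `z₂` by `tau`.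
  let act : Fin 3 → Equiv.Perm F :=
    ![Equiv.mulLeft x * tau.toEquiv, tau.toEquiv, tau.toEquiv * Equiv.mulLeft y]
  have hact : ∀ i, act i * act i = 1 := fun i => by
    ext1 w
    fin_cases i <;> simp [act]
  have hmul : ((psiLift act hact).comp inclF) = MulAction.toPermHom F F := by
    refine FreeGroup.ext_hom _ _ fun i => Equiv.ext fun w => ?_
    fin_cases i <;> simp [inclF, act, x, y]
  refine Function.Injective.of_comp (f := psiLift act hact) ?_
  rw [← MonoidHom.coe_comp, hmul]
  exact MulAction.toPerm_injective

theorem exists_nuPsi_z_one_eq (r : Phi) : ∃ e, nuPsi r (z 1) = inclF e * z 1 := by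
  induction r using FreeGroup.induction_on with
  | C1 => exact ⟨1, by simp⟩
  | of i =>
    fin_cases i
    · exact ⟨(x * x)⁻¹, by simp [nuPsi, alphaPsi_z, inclF_x, mul_assoc]⟩
    · exact ⟨(y * y)⁻¹, by simp [nuPsi, betaPsi_z, inclF_y, mul_assoc]⟩
  | inv_of i ih =>
    obtain ⟨e, he⟩ := ih
    refine ⟨nu0 (.of i)⁻¹ e⁻¹, (nuPsi (.of i)).injective ?_⟩
    rw [inclF_nu0, map_mul, map_inv nuPsi, MulAut.apply_inv_self, MulAut.apply_inv_self, he,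
      map_inv, inv_mul_cancel_left]
  | mul a b ha hb =>
    obtain ⟨e₁, h₁⟩ := ha
    obtain ⟨e₂, h₂⟩ := hb
    refine ⟨nu0 a e₂ * e₁, ?_⟩
    rw [map_mul, MulAut.mul_apply, h₂, map_mul, h₁, map_mul, ← inclF_nu0, mul_assoc]

theorem nu0_tau {r : Phi} {e : F} (he : nuPsi r (z 1) = inclF e * z 1) (w : F) :
    nu0 r (tau w) = e * tau (nu0 r w) * e⁻¹ := by
  have he' : nuPsi r (z 1) = z 1 * (inclF e)⁻¹ := by
    rw [← z_inv, map_inv, he, mul_inv_rev]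
  apply inclF_injective
  rw [inclF_nu0, inclF_tau, map_mul, map_mul]
  nth_rw 1 [he]
  rw [he', ← inclF_nu0, map_mul, map_mul, inclF_tau, map_inv]
  simp only [mul_assoc]

/-! ### `F′` as a subgroup of `Ψ` -/

/-- The automorphism of `F′` induced by conjugation by `zᵢ`. -/
def conjZ (i : Fin 3) : FreeGroup (Fin 3) →* FreeGroup (Fin 3) :=
  FreeGroup.lift (![![.of 1, .of 0, (.of 0 * .of 2 * .of 1)⁻¹],
    ![(.of 1 * .of 0 * .of 2)⁻¹, .of 2, .of 1],
    ![.of 2, (.of 2 * .of 1 * .of 0)⁻¹, .of 0]] i)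

theorem inclF'_conjZ (i : Fin 3) (f : FreeGroup (Fin 3)) :
    inclF' (conjZ i f) = z i * inclF' f * z i := by
  have h : inclF'.comp (conjZ i) = (MulAut.conj (z i)).toMonoidHom.comp inclF' := by
    refine FreeGroup.ext_hom _ _ fun j => ?_
    fin_cases i <;> fin_cases j <;> simp [conjZ, inclF', mul_assoc]
  simpa using DFunLike.congr_fun h f

theorem conjZ_conjZ (i : Fin 3) (f : FreeGroup (Fin 3)) : conjZ i (conjZ i f) = f := by
  have h : (conjZ i).comp (conjZ i) = MonoidHom.id _ := by
    refine FreeGroup.ext_hom _ _ fun j => ?_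
    fin_cases i <;> fin_cases j <;> simp [conjZ, mul_assoc]
  exact DFunLike.congr_fun h f

theorem conjZ_cyclic (i : Fin 3) (f : FreeGroup (Fin 3)) :
    conjZ i (conjZ (i + 1) (conjZ (i + 2) f)) = .of i * f * (.of i)⁻¹ := by
  have h : (conjZ i).comp ((conjZ (i + 1)).comp (conjZ (i + 2))) =
      (MulAut.conj (FreeGroup.of i)).toMonoidHom := by
    refine FreeGroup.ext_hom _ _ fun j => ?_
    fin_cases i <;> fin_cases j <;> simp [conjZ, mul_assoc]
  exact DFunLike.congr_fun h f

instance range_inclF'_normal : inclF'.range.Normal := by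
  refine normal_of_conj_z_mem ?_
  rintro i _ ⟨f, rfl⟩
  exact ⟨conjZ i f, inclF'_conjZ i f⟩

/-- The permutation by which `zᵢ` acts on `Ψ = F′ · {1, z₁, z₂, z₃}` from the left: it sends `f z_k`
to `zᵢ f z_k = (zᵢ f zᵢ) (zᵢ z_k)`, where `zᵢ z_k ∈ F′ · {1, z₁, z₂, z₃}` is read off from
`u = z₁z₂z₃`, `v = z₂z₃z₁` and `w = z₃z₁z₂`. -/
def permZ (i : Fin 3) : Equiv.Perm (FreeGroup (Fin 3) × Fin 4) :=
  let c : Fin 3 → Fin 4 → FreeGroup (Fin 3) :=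
    ![![1, 1, .of 0, (.of 1)⁻¹], ![1, (.of 2)⁻¹, 1, .of 1], ![1, .of 2, (.of 0)⁻¹, 1]]
  let s : Fin 3 → Fin 4 → Fin 4 := ![![1, 0, 3, 2], ![2, 3, 0, 1], ![3, 2, 1, 0]]
  Function.Involutive.toPerm (fun k => (conjZ i k.1 * c i k.2, s i k.2)) (by
    rintro ⟨f, k⟩
    have h : conjZ i (c i k) * c i (s i k) = 1 := by
      fin_cases i <;> fin_cases k <;> simp [c, s, conjZ]
    refine Prod.ext ?_ ?_
    · simp only [map_mul, conjZ_conjZ, mul_assoc, h, mul_one]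
    · fin_cases i <;> fin_cases k <;> rfl)

theorem inclF'_injective : Function.Injective inclF' := by
  let Θ : Psi →* Equiv.Perm (FreeGroup (Fin 3) × Fin 4) :=
    psiLift permZ fun i => Equiv.ext (permZ i).symm_apply_apply
  have hof (i : Fin 3) (f : FreeGroup (Fin 3)) : Θ (inclF' (.of i)) (f, 0) = (.of i * f, 0) := by
    have h : conjZ i (conjZ (i + 1) (conjZ (i + 2) f)) * .of i = .of i * f := by
      rw [conjZ_cyclic, inv_mul_cancel_right]
    rw [← h]
    fin_cases i <;> simp [Θ, inclF', permZ] <;> simp [conjZ]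
  have htranslate (g f : FreeGroup (Fin 3)) : Θ (inclF' g) (f, 0) = (g * f, 0) := by
    induction g using FreeGroup.induction_on generalizing f with
    | C1 => simp
    | of i => exact hof i f
    | inv_of i h => rw [map_inv, map_inv, Equiv.Perm.inv_eq_iff_eq, h, mul_inv_cancel_left]
    | mul a b ha hb => rw [map_mul, map_mul, Equiv.Perm.mul_apply, hb, ha, mul_assoc]
  intro g h hgh
  simpa [htranslate] using congrArg (fun w => Θ w (1, 0)) hgh

theorem phi_bijective : Function.Bijective phi := by
  let ψ : Fbar →* Phi := FreeGroup.lift ![(.of 1)⁻¹, .of 1 * (.of 0)⁻¹]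
  have h₁ : ψ.comp phi = MonoidHom.id _ := by
    refine FreeGroup.ext_hom _ _ fun i => ?_
    fin_cases i <;> simp [ψ, phi]
  have h₂ : phi.comp ψ = MonoidHom.id _ := by
    refine FreeGroup.ext_hom _ _ fun i => ?_
    fin_cases i <;> simp [ψ, phi]
  exact Function.bijective_iff_has_inverse.2 ⟨ψ, DFunLike.congr_fun h₁, DFunLike.congr_fun h₂⟩

/-! ### Indices -/

section Index

theorem index_inf_dvd {G : Type*} [Group G] (A : Subgroup G) [A.Normal] {B L : Subgroup G}
    (hB : B ≤ L) : (A ⊓ B).index ∣ A.relIndex L * B.index := by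
  rw [← Subgroup.relIndex_mul_index (inf_le_right : A ⊓ B ≤ B), Subgroup.inf_relIndex_right,
    ← Subgroup.relIndex_subgroupOf hB]
  exact mul_dvd_mul_right (Subgroup.relIndex_dvd_index_of_normal _ _) _

theorem conj_mem_of_mk_eq {G : Type*} [Group G] {P M : Subgroup G} [P.Normal]
    [hM : (M.subgroupOf P).Normal] {g r h : G} (hgr : (r : G ⧸ P) = g) (hh : h ∈ P)
    (hr : r * h * r⁻¹ ∈ M) : g * h * g⁻¹ ∈ M := by
  have hP : g * r⁻¹ ∈ P := by
    simpa [mul_assoc] using ‹P.Normal›.conj_mem _ (QuotientGroup.eq.1 hgr) r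
  have hconj := hM.conj_mem ⟨_, ‹P.Normal›.conj_mem h hh r⟩ hr ⟨_, hP⟩
  simpa [Subgroup.mem_subgroupOf, mul_assoc] using hconj

theorem relIndex_normalCore_dvd {G : Type*} [Group G] (P M : Subgroup G) [P.Normal]
    [P.FiniteIndex] [(M.subgroupOf P).Normal] :
    M.normalCore.relIndex P ∣ M.relIndex P ^ P.index := by
  let f : P →* (G ⧸ P → P ⧸ M.subgroupOf P) := MonoidHom.pi fun c =>
    (QuotientGroup.mk' (M.subgroupOf P)).comp (MulAut.conjNormal c.out).toMonoidHom
  have hf (h : P) (c : G ⧸ P) : f h c = 1 ↔ c.out * h * c.out⁻¹ ∈ M := by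
    change QuotientGroup.mk' _ (MulAut.conjNormal c.out h) = 1 ↔ _
    rw [QuotientGroup.mk'_apply, QuotientGroup.eq_one_iff, Subgroup.mem_subgroupOf,
      MulAut.conjNormal_apply]
  have hker : f.ker = M.normalCore.subgroupOf P := by
    ext h
    rw [MonoidHom.mem_ker, Subgroup.mem_subgroupOf, funext_iff]
    exact ⟨fun H g => conj_mem_of_mk_eq (Quotient.out_eq' _) h.2 ((hf h (g : G ⧸ P)).1 (H _)),
      fun H c => (hf h c).2 (H c.out)⟩
  have hcard : Nat.card (G ⧸ P → P ⧸ M.subgroupOf P) = M.relIndex P ^ P.index := Nat.card_fun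
  rw [Subgroup.relIndex, ← hker, Subgroup.index_ker, ← hcard]
  exact Subgroup.card_subgroup_dvd_card _

theorem powComm_le_ker {G A : Type*} [Group G] [CommGroup A] {k : ℕ} (hA : ∀ a : A, a ^ k = 1)
    (f : G →* A) (H : Subgroup G) : powComm k H ≤ f.ker :=
  powComm_le_iff.2 ⟨fun h _ => by rw [MonoidHom.mem_ker, map_pow, hA],
    (Subgroup.commutator_mono le_top le_top).trans (Abelianization.commutator_subset_ker f)⟩

theorem dvd_expSum_of_mem_powComm {k : ℕ} {w : F} {H : Subgroup F} (hw : w ∈ powComm k H)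
    (i : Fin 2) : (k : ℤ) ∣ (expSum w).toAdd i := by
  let f : F →* Multiplicative (ZMod k) := (AddMonoidHom.toMultiplicative
    ((Int.castAddHom (ZMod k)).comp (Pi.evalAddMonoidHom _ i))).comp expSum
  exact (ZMod.intCast_zmod_eq_zero_iff_dvd _ k).1 (powComm_le_ker
    (fun a => Multiplicative.toAdd.injective (by simp)) f H hw)

section FreeGroup

variable {α : Type*}

theorem powComm_top_le_of_generators {k : ℕ} {Q : Subgroup (FreeGroup α)} [Q.Normal]
    (hpow : ∀ i, FreeGroup.of i ^ k ∈ Q) (hcomm : ∀ i j : α, ⁅FreeGroup.of i, FreeGroup.of j⁆ ∈ Q) :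
    powComm k ⊤ ≤ Q := by
  let π := QuotientGroup.mk' Q
  have hπ (w : FreeGroup α) : π w = 1 ↔ w ∈ Q := QuotientGroup.eq_one_iff w
  have hgen (i : α) (w : FreeGroup α) : Commute (π (.of i)) (π w) := by
    induction w using FreeGroup.induction_on with
    | C1 => simp
    | of j =>
      rw [← commutatorElement_eq_one_iff_commute, ← map_commutatorElement]
      exact (hπ _).2 (hcomm i j)
    | inv_of j hj => simpa using hj
    | mul a b ha hb => simpa using ha.mul_right hb
  have hab (v w : FreeGroup α) : Commute (π v) (π w) := by
    induction v using FreeGroup.induction_on with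
    | C1 => simp
    | of i => exact hgen i w
    | inv_of i hi => simpa using hi
    | mul a b ha hb => simpa using ha.mul_left hb
  have hexp (w : FreeGroup α) : π w ^ k = 1 := by
    induction w using FreeGroup.induction_on with
    | C1 => simp
    | of i => rw [← map_pow]; exact (hπ _).2 (hpow i)
    | inv_of i hi => simpa using hi
    | mul a b ha hb => rw [map_mul, (hab a b).mul_pow, ha, hb, one_mul]
  refine powComm_le_iff.2 ⟨fun w _ => (hπ _).1 (by rw [map_pow, hexp]), ?_⟩
  refine Subgroup.commutator_le.2 fun v _ w _ => (hπ _).1 ?_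
  rw [map_commutatorElement, commutatorElement_eq_one_iff_commute.2 (hab v w)]

theorem index_powComm_dvd [Finite α] [Nonempty α] (k : ℕ) {n : ℕ} (hn : n ≠ 0)
    {H : Subgroup (FreeGroup α)} [H.Normal] (hH : H.index ∣ n) :
    (powComm k H).index ∣ n * k ^ ((Nat.card α - 1) * n + 1) := by
  have : H.FiniteIndex := ⟨ne_zero_of_dvd_ne_zero hn hH⟩
  have hle : H.index ≤ n := Nat.le_of_dvd (Nat.pos_of_ne_zero hn) hH
  rw [← Subgroup.relIndex_mul_index (powComm_le k H), mul_comm n]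
  exact mul_dvd_mul ((relIndex_powComm_dvd k H).trans (pow_dvd_pow k (by gcongr))) hH

theorem index_powComm_top [Finite α] [Nonempty α] (k : ℕ) :
    (powComm k (⊤ : Subgroup (FreeGroup α))).index = k ^ Nat.card α := by
  classical
  cases nonempty_fintype α
  apply Nat.dvd_antisymm
  · have h := index_powComm_dvd k one_ne_zero (Subgroup.index_top (G := FreeGroup α)).dvd
    rwa [one_mul, mul_one, Nat.sub_add_cancel Nat.card_pos] at h
  · let f : FreeGroup α →* Multiplicative (α → ZMod k) :=
      FreeGroup.lift fun i => .ofAdd (Pi.single i 1)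
    have hf : Function.Surjective f := fun v => by
      choose n hn using fun i => ZMod.intCast_surjective (v.toAdd i)
      have hv : v = ∏ i, f (.of i ^ n i) := by
        apply Multiplicative.toAdd.injective
        funext j
        simp [f, toAdd_prod, Pi.single_apply, hn]
      rw [hv]
      exact Subgroup.prod_mem f.range fun i _ => ⟨_, rfl⟩
    have hle : powComm k ⊤ ≤ f.ker :=
      powComm_le_ker (fun a => Multiplicative.toAdd.injective (funext fun i => by simp)) f ⊤
    have hker : f.ker.index = k ^ Nat.card α := by
      rw [Subgroup.index_ker, MonoidHom.range_eq_top.2 hf, Subgroup.card_top,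
        Nat.card_congr Multiplicative.toAdd, Nat.card_fun, Nat.card_zmod]
    exact hker ▸ Subgroup.index_dvd_of_le hle

end FreeGroup

theorem index_powComm_top_F (k : ℕ) : (powComm k (⊤ : Subgroup F)).index = k ^ 2 := by
  simpa using index_powComm_top (α := Fin 2) k

theorem powComm_two_le_comap_range : powComm 2 (⊤ : Subgroup F) ≤ inclF'.range.comap inclF := by
  refine powComm_top_le_of_generators (Fin.forall_fin_two.2 ⟨?_, ?_⟩)
    (Fin.forall_fin_two.2 ⟨Fin.forall_fin_two.2 ⟨?_, ?_⟩, Fin.forall_fin_two.2 ⟨?_, ?_⟩⟩)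
  · exact ⟨.of 0 * .of 2, by simp [inclF', inclF, pow_two, mul_assoc]⟩
  · exact ⟨.of 1 * .of 0, by simp [inclF', inclF, pow_two, mul_assoc]⟩
  · simp
  · exact ⟨(.of 1 * .of 1)⁻¹, by simp [inclF', inclF, commutatorElement_def, mul_assoc]⟩
  · exact ⟨.of 1 * .of 1, by simp [inclF', inclF, commutatorElement_def, mul_assoc]⟩
  · simp

theorem exists_lift_powComm_two :
    ∃ j : powComm 2 (⊤ : Subgroup F) →* FreeGroup (Fin 3), ∀ h, inclF' (j h) = inclF h := by
  let e := MonoidHom.ofInjective inclF'_injective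
  let k : powComm 2 (⊤ : Subgroup F) →* inclF'.range :=
    (inclF.comp (Subgroup.subtype _)).codRestrict _ fun h => powComm_two_le_comap_range h.2
  exact ⟨e.symm.toMonoidHom.comp k, fun h => congrArg Subtype.val (e.apply_symm_apply (k h))⟩

variable (N : Subgroup (MulAut F)) (p q : ℕ)

instance powComm_top_normal (k : ℕ) : (powComm k (⊤ : Subgroup F)).Normal := powComm_normal k ⊤

instance scriptN_normal [N.Normal] : (scriptN N).Normal := inferInstanceAs (N.comap nu0).Normal

instance map_phi_scriptM_normal [N.Normal] : ((scriptM N p).map phi).Normal :=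
  (powComm_normal p (scriptN N)).map phi phi_bijective.2

instance subgroupS_normal : (subgroupS N p).Normal := Subgroup.normalCore_normal _

instance subgroupT_normal : (subgroupT N p).Normal := Subgroup.normal_inf_normal _ _

instance subgroupU_normal : (subgroupU N p q).Normal := powComm_normal q _

theorem subgroupK_normal : (subgroupK N p q).Normal := Subgroup.normal_inf_normal _ _

theorem exists_subgroupOf_eq_comap : ∃ f : powComm 2 (⊤ : Subgroup F) →* Fbar,
    (subgroupM N p).subgroupOf (powComm 2 ⊤) = ((scriptM N p).map phi).comap f := by
  obtain ⟨j, hj⟩ := exists_lift_powComm_two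
  refine ⟨rho.comp j, ?_⟩
  ext h
  rw [Subgroup.mem_subgroupOf, subgroupM, Subgroup.mem_comap, ← hj,
    Subgroup.mem_map_iff_mem inclF'_injective]
  rfl

instance subgroupM_subgroupOf_normal [N.Normal] :
    ((subgroupM N p).subgroupOf (powComm 2 ⊤)).Normal := by
  obtain ⟨f, hf⟩ := exists_subgroupOf_eq_comap N p
  rw [hf]
  infer_instance

theorem relIndex_subgroupM_dvd [N.Normal] :
    (subgroupM N p).relIndex (powComm 2 ⊤) ∣ (scriptM N p).index := by
  obtain ⟨f, hf⟩ := exists_subgroupOf_eq_comap N p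
  rw [Subgroup.relIndex, hf, Subgroup.index_comap]
  exact (Subgroup.relIndex_dvd_index_of_normal _ _).trans
    (Subgroup.index_map_dvd _ phi_bijective.2)

theorem relIndex_subgroupS_dvd [N.Normal] :
    (subgroupS N p).relIndex (powComm 2 ⊤) ∣ (scriptM N p).index ^ 4 := by
  have h2 := index_powComm_top_F 2
  have : (powComm 2 (⊤ : Subgroup F)).FiniteIndex := ⟨by simp [h2]⟩
  have h := relIndex_normalCore_dvd (powComm 2 (⊤ : Subgroup F)) (subgroupM N p)
  rw [h2] at h
  exact h.trans (pow_dvd_pow_of_dvd (relIndex_subgroupM_dvd N p) 4)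

theorem index_scriptN_dvd [N.Normal] : (scriptN N).index ∣ N.relIndex autPrime := by
  rw [scriptN, Subgroup.index_comap, ← Subgroup.relIndex_subgroupOf range_nu0_le_autPrime]
  exact Subgroup.relIndex_dvd_index_of_normal _ _

variable {N}

theorem index_scriptM_dvd [N.Normal] {n : ℕ} (hn : n ≠ 0) (hd : (scriptN N).index ∣ n) :
    (scriptM N p).index ∣ n * p ^ (n + 1) := by
  simpa [scriptM] using index_powComm_dvd p hn hd

variable {p}

theorem index_subgroupT_dvd [N.Normal] {m : ℕ} (hm : (scriptM N p).index ∣ m) :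
    (subgroupT N p).index ∣ 36 * m ^ 4 := by
  have h := index_inf_dvd (subgroupS N p)
    (powComm_le_of_dvd (by norm_num : 2 ∣ 6) (⊤ : Subgroup F))
  rw [index_powComm_top_F, mul_comm] at h
  exact h.trans (mul_dvd_mul_left 36
    ((relIndex_subgroupS_dvd N p).trans (pow_dvd_pow_of_dvd hm 4)))

theorem subgroupU_le_powComm_two : subgroupU N p q ≤ powComm 2 ⊤ :=
  (powComm_le _ _).trans (inf_le_right.trans (powComm_le_of_dvd (by norm_num) _))

theorem index_subgroupK_dvd [N.Normal] {m : ℕ} (hm0 : m ≠ 0) (hm : (scriptM N p).index ∣ m) :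
    (subgroupK N p q).index ∣ 144 * m ^ 4 * q ^ (36 * m ^ 4 + 1) := by
  have hU : (subgroupU N p q).index ∣ 36 * m ^ 4 * q ^ (36 * m ^ 4 + 1) := by
    simpa [subgroupU] using index_powComm_dvd q (by positivity) (index_subgroupT_dvd hm)
  calc (subgroupK N p q).index
    _ ∣ (subgroupU N p q).relIndex (powComm 2 ⊤) * (powComm 4 (⊤ : Subgroup F)).index :=
      index_inf_dvd _ (powComm_le_of_dvd (by norm_num) _)
    _ = 4 * (subgroupU N p q).index := by
      rw [← Subgroup.relIndex_mul_index (subgroupU_le_powComm_two q), index_powComm_top_F,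
        index_powComm_top_F]
      ring
    _ ∣ 4 * (36 * m ^ 4 * q ^ (36 * m ^ 4 + 1)) := mul_dvd_mul_left 4 hU
    _ = 144 * m ^ 4 * q ^ (36 * m ^ 4 + 1) := by ring

end Index

/-! ### The congruence subgroup of `K` -/

section Congruence

theorem apply_mul_inv_mem {G : Type*} [Group G] {K : Subgroup G} [K.Normal] {σ : MulAut G}
    (hσ : σ ∈ congruenceSubgroup K) (g : G) : σ g * g⁻¹ ∈ K := by
  simpa [mul_assoc] using ‹K.Normal›.conj_mem _ (inv_mem (QuotientGroup.eq.1 (hσ.2 g))) g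

theorem mem_intNu_of_mem_congruenceSubgroup {K : Subgroup F} [K.Normal] (hK : K ≤ powComm 4 ⊤)
    {σ : MulAut F} (hσ : σ ∈ congruenceSubgroup K) : σ ∈ intNu := by
  have h (i j : Fin 2) : (4 : ℤ) ∣ abMatrix σ i j - (expSum (.of j)).toAdd i := by
    simpa [abMatrix, sub_eq_add_neg] using
      dvd_expSum_of_mem_powComm (hK (apply_mul_inv_mem hσ (.of j))) i
  refine mem_intNu_of_isSanov ⟨?_, ?_, Dvd.dvd.trans (by norm_num) (b := 4) ?_,
    Dvd.dvd.trans (by norm_num) (b := 4) ?_⟩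
  · simpa [expSum] using h 0 0
  · simpa [expSum] using h 1 1
  · simpa [expSum] using h 0 1
  · simpa [expSum] using h 1 0

variable {N : Subgroup (MulAut F)} {p q : ℕ}

theorem map_inclF_subgroupT_le : (subgroupT N p).map inclF ≤
    (((scriptM N p).map phi).comap rho).map inclF' :=
  Subgroup.map_le_iff_le_comap.2 (inf_le_left.trans (Subgroup.normalCore_le _))

theorem exists_inclF'_eq_of_commutator_mem [(subgroupT N p).FiniteIndex] (hq : 2 < q) {g : F}
    (hg : ⁅g, ⁅y, x⁆⁆ ∈ subgroupU N p q) :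
    ∃ f, inclF' f = inclF g ∧ rho f ∈ (scriptM N p).map phi := by
  obtain ⟨j, hj⟩ := map_mem_zpowers_commutator (π := QuotientGroup.mk' (subgroupT N p)) hq
    (by rwa [QuotientGroup.ker_mk'])
  have ht : (⁅y, x⁆ ^ j)⁻¹ * g ∈ subgroupT N p := QuotientGroup.eq.1 hj
  obtain ⟨k, hk, hkt⟩ := map_inclF_subgroupT_le ⟨_, ht, rfl⟩
  have hv : inclF' (.of 1 * .of 1) = inclF ⁅y, x⁆ := by
    simp [inclF', inclF_x, inclF_y, commutatorElement_def, mul_assoc]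
  refine ⟨(.of 1 * .of 1) ^ j * k, ?_, ?_⟩
  · rw [map_mul, map_zpow, hv, hkt, ← map_zpow, ← map_mul, mul_inv_cancel_left]
  · simpa [rho] using hk

theorem commutator_mem_scriptM {μ r : Phi} {f : FreeGroup (Fin 3)} (hf : rho f = phi μ)
    (hT : ∀ w, inclF' f * nuPsi r w * (inclF' f)⁻¹ * w⁻¹ ∈ (subgroupT N p).map inclF) (w : Phi) :
    ⁅μ * r, w⁆ ∈ scriptM N p := by
  obtain ⟨l, hl⟩ : ∃ l, rho l = phi w := by
    have h : rho.comp (FreeGroup.lift ![.of 0, .of 2]) = MonoidHom.id Fbar := by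
      refine FreeGroup.ext_hom _ _ fun i => ?_
      fin_cases i <;> simp [rho]
    exact ⟨_, DFunLike.congr_fun h (phi w)⟩
  have hmem := map_inclF_subgroupT_le (hT (inclF' l))
  rw [← inclF'_nuF', ← map_inv, ← map_inv, ← map_mul, ← map_mul, ← map_mul,
    Subgroup.mem_map_iff_mem inclF'_injective, Subgroup.mem_comap] at hmem
  rw [← Subgroup.mem_map_iff_mem phi_bijective.1]
  simpa [commutatorElement_def, rho_nuF', hf, hl, mul_assoc] using hmem

variable [N.Normal]

theorem tau_mem_subgroupS {w : F} (hw : w ∈ subgroupS N p) : tau w ∈ subgroupS N p := by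
  intro g
  obtain ⟨k, hk, hkw⟩ := hw (y * x * tau g)
  -- `z₂ = (yx)⁻¹ v` in `Ψ`, and conjugation by `v` preserves `ρ⁻¹(φ(ℳ))`.
  have hv : inclF' (.of 1) = inclF (y * x) * z 1 := by
    simp [inclF', inclF_x, inclF_y, mul_assoc]
  refine ⟨_, (Subgroup.Normal.comap inferInstance rho).conj_mem k hk (.of 1)⁻¹, ?_⟩
  rw [map_mul, map_mul, hkw, map_inv, map_inv, map_inv, hv]
  simp [inclF_tau, mul_assoc]

theorem tau_mem_subgroupT {w : F} (hw : w ∈ subgroupT N p) : tau w ∈ subgroupT N p :=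
  ⟨tau_mem_subgroupS hw.1, map_mem_powComm (f := tau.toMonoidHom) le_top hw.2⟩

theorem tau_mem_subgroupU {w : F} (hw : w ∈ subgroupU N p q) : tau w ∈ subgroupU N p q :=
  map_mem_powComm (f := tau.toMonoidHom)
    (Subgroup.map_le_iff_le_comap.2 fun _ => tau_mem_subgroupT) hw

instance map_inclF_subgroupT_normal : ((subgroupT N p).map inclF).Normal := by
  refine normal_of_conj_z_mem ?_
  rintro i _ ⟨t, ht, rfl⟩
  have hconj := (subgroupT_normal N p).conj_mem
  fin_cases i
  · exact ⟨_, hconj _ (tau_mem_subgroupT ht) x, by simp [inclF_tau, inclF_x, mul_assoc]⟩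
  · exact ⟨_, tau_mem_subgroupT ht, inclF_tau t⟩
  · exact ⟨_, tau_mem_subgroupT (hconj t ht y), by simp [inclF_tau, inclF_y, mul_assoc]⟩

theorem mul_mul_tau_inv_mem_subgroupT [(subgroupT N p).FiniteIndex] (hq : 2 < q) {g e : F} {r : Phi}
    (hU : ∀ w, g * nu0 r w * g⁻¹ * w⁻¹ ∈ subgroupU N p q)
    (he : nuPsi r (z 1) = inclF e * z 1) : g * e * (tau g)⁻¹ ∈ subgroupT N p := by
  set d := g * e * (tau g)⁻¹ with hd
  rw [← QuotientGroup.ker_mk' (subgroupT N p)]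
  refine mem_ker_of_forall_commutator_mem hq fun w => ?_
  rw [QuotientGroup.ker_mk']
  let s := g * nu0 r (tau w) * g⁻¹ * (tau w)⁻¹
  have hs : d * tau s * d⁻¹ ∈ subgroupU N p q :=
    (subgroupU_normal N p q).conj_mem _ (tau_mem_subgroupU (hU (tau w))) d
  have hw : nu0 r w = e * tau (nu0 r (tau w)) * e⁻¹ := by rw [← nu0_tau he, tau_tau]
  have hdw : ⁅d, w⁆ = (d * tau s * d⁻¹)⁻¹ * (g * nu0 r w * g⁻¹ * w⁻¹) := by
    rw [hw, commutatorElement_def]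
    simp only [s, hd, map_mul, map_inv, tau_tau]
    group
  exact hdw ▸ mul_mem (inv_mem hs) (hU w)

theorem conj_nuPsi_mul_inv_mem [(subgroupT N p).FiniteIndex] (hq : 2 < q) {g : F} {r : Phi}
    (hU : ∀ w, g * nu0 r w * g⁻¹ * w⁻¹ ∈ subgroupU N p q) (w : Psi) :
    inclF g * nuPsi r w * (inclF g)⁻¹ * w⁻¹ ∈ (subgroupT N p).map inclF := by
  let π := QuotientGroup.mk' ((subgroupT N p).map inclF)
  have hπ (a b : Psi) : π a = π b ↔ a * b⁻¹ ∈ (subgroupT N p).map inclF := by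
    rw [← mul_inv_eq_one, ← map_inv, ← map_mul]
    exact QuotientGroup.eq_one_iff _
  obtain ⟨e, he⟩ := exists_nuPsi_z_one_eq r
  have hfix : π.comp ((MulAut.conj (inclF g)).toMonoidHom.comp (nuPsi r).toMonoidHom) = π := by
    refine psi_hom_ext_inclF (fun w => (hπ _ _).2 ⟨_, powComm_le q _ (hU w), ?_⟩)
      ((hπ _ _).2 ⟨_, mul_mul_tau_inv_mem_subgroupT hq hU he, ?_⟩)
    · simp [inclF_nu0]
    · simp [he, inclF_tau, mul_assoc]
  exact (hπ _ _).1 (DFunLike.congr_fun hfix w)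

theorem congruenceSubgroup_subgroupK_le (hp : 2 < p) (hq : 2 < q) (hInt : intF ≤ N)
    [(scriptN N).FiniteIndex] [(subgroupT N p).FiniteIndex] :
    congruenceSubgroup (subgroupK N p q) ≤ N := by
  intro σ hσ
  have := subgroupK_normal N p q
  obtain ⟨g, r, rfl⟩ := mem_intNu.1 (mem_intNu_of_mem_congruenceSubgroup inf_le_right hσ)
  suffices hr : r ∈ scriptN N from mul_mem (hInt ⟨g, rfl⟩) hr
  have hU (w : F) : g * nu0 r w * g⁻¹ * w⁻¹ ∈ subgroupU N p q := (apply_mul_inv_mem hσ w).1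
  obtain ⟨f, hfg, μ, hμ, hμf⟩ := exists_inclF'_eq_of_commutator_mem hq (g := g)
    (nu0_commutator r ▸ hU ⁅y, x⁆)
  have hcomm := commutator_mem_scriptM hμf.symm fun w => hfg ▸ conj_nuPsi_mul_inv_mem hq hU w
  have hμr : μ * r ∈ (QuotientGroup.mk' (scriptN N)).ker :=
    mem_ker_of_forall_commutator_mem hp fun w => by simpa [scriptM] using hcomm w
  rw [QuotientGroup.ker_mk'] at hμr
  exact (Subgroup.mul_mem_cancel_left _ (powComm_le p _ hμ)).1 hμr

end Congruence

end AutF2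


theorem theorem5p1_general (N : Subgroup (MulAut AutF2.F)) (hnormal : N.Normal)
    (hfinite : N.FiniteIndex) (hInt : AutF2.intF ≤ N)
    (n : ℕ) (hn : n = N.relIndex AutF2.autPrime)
    (p q : ℕ) (hp : 2 < p) (hq : 2 < q)
    (m : ℕ) (hm : m = n * p ^ (n + 1)) :
    (AutF2.subgroupK N p q).Normal ∧
      (AutF2.subgroupK N p q).index ∣ 144 * m ^ 4 * q ^ (36 * m ^ 4 + 1) ∧
      AutF2.congruenceSubgroup (AutF2.subgroupK N p q) ≤ N := by
  have hn0 : n ≠ 0 :=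
    hn ▸ fun h => hfinite.index_ne_zero (Subgroup.index_eq_zero_of_relIndex_eq_zero h)
  have hm0 : m ≠ 0 := hm ▸ mul_ne_zero hn0 (pow_ne_zero _ (by omega))
  have hN : (AutF2.scriptN N).index ∣ n := hn ▸ AutF2.index_scriptN_dvd N
  have hM : (AutF2.scriptM N p).index ∣ m := hm ▸ AutF2.index_scriptM_dvd p hn0 hN
  have : (AutF2.scriptN N).FiniteIndex := ⟨ne_zero_of_dvd_ne_zero hn0 hN⟩
  have : (AutF2.subgroupT N p).FiniteIndex :=
    ⟨ne_zero_of_dvd_ne_zero (by positivity) (AutF2.index_subgroupT_dvd hM)⟩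
  exact ⟨AutF2.subgroupK_normal N p q, AutF2.index_subgroupK_dvd q hm0 hM,
    AutF2.congruenceSubgroup_subgroupK_le hp hq hInt⟩

/-- The subgroup `K` constructed explicitly from `N`, `p`, `q` is normal in `F`, its index divides
`144 m⁴ q^(36 m⁴ + 1)`, and `Γ[K] ⊆ N`. -/
theorem theorem5p1 (N : Subgroup (MulAut AutF2.F)) (hnormal : N.Normal)
    (hfinite : N.FiniteIndex) (hInt : AutF2.intF ≤ N) (hAut : N ≤ AutF2.autPrime)
    (n : ℕ) (hn : n = N.relIndex AutF2.autPrime)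
    (p q : ℕ) (hp : p.Prime) (hq : q.Prime) (hp2 : Odd p) (hq2 : Odd q) (hpq : p ≠ q)
    (hpn : ¬ p ∣ n) (hqn : ¬ q ∣ n)
    (m : ℕ) (hm : m = n * p ^ (n + 1)) :
    (AutF2.subgroupK N p q).Normal ∧
      (AutF2.subgroupK N p q).index ∣ 144 * m ^ 4 * q ^ (36 * m ^ 4 + 1) ∧
      AutF2.congruenceSubgroup (AutF2.subgroupK N p q) ≤ N :=
  theorem5p1_general N hnormal hfinite hInt n hn p q
    (hp.two_le.lt_of_ne' (hp2.ne_two_of_dvd_nat dvd_rfl))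
    (hq.two_le.lt_of_ne' (hq2.ne_two_of_dvd_nat dvd_rfl)) m hm
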